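/- Let $H$ be a group with a countable generating set $X=\{x_1,x_2,\ldots\}$, given by an effectively coded indexing $i\mapsto x_i$ (e.g. by $\mathbb N$ or by a finite set; repetitions are allowed). For a group $K$ with an indexed generating family $Y$, words over $Y\cup Y^{-1}$ mean words in the indices and their formal inverses. $K$ is said to have a recursive presentation with respect to $Y$ if the set of words over $Y\cup Y^{-1}$ that represent $1$ is recursively enumerable, and to be computable with respect to $Y$ if this set is recursive. A linear order $\preceq$ on $K$ is computable with respect to $Y$ if the set of pairs $(u,v)$ of words with $u\preceq v$ in $K$ is recursive. $K$ has a recursive presentation if it has one with respect to some countable generating family, and it has decidable word problem if it is computable with respect to some finite generating family. A left order is a linear order invariant under left multiplication, and a bi-order is a left order that is also invariant under right multiplication. Then there exist elements $f,s$ of the unrestricted iterated wreath product $(H\wr\mathbb Z)\wr\mathbb Z$ and, with $G=\langle f,s\rangle$, an injective homomorphism $\Phi:H\hookrightarrow G$ such that: (a) there is a computable map $i\mapsto w_i\in\{f^{\pm1},s^{\pm1}\}^*$ such that the word $w_i$ represents $\Phi(x_i)$ in $G$; (b) if $H$ is solvable of derived length $l$, then $G$ is solvable of derived length $l+2$; (c)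 $G$ has a recursive presentation if and only if $H$ has a recursive presentation with respect to $X$; (d) $G$ has decidable word problem if and only if $H$ is computable with respect to $X$; (e) if $H$ is computable with respect to $X$, then the set of words over $\{f^{\pm1},s^{\pm1}\}$ that represent an element of $\Phi(H)$ is recursive; (f) for every left order (respectively, bi-order) $\preceq_H$ on $H$ there is a left order (respectively, bi-order) $\preceq_G$ on $G$ such that $a\preceq_H b$ if and only if $\Phi(a)\preceq_G\Phi(b)$ for all $a,b\in H$; if $\preceq_H$ is computable with respect to $X$, then $\preceq_G$ can be chosen to be computable with respect to $\{f,s\}$; (g) there are subgroups $N_1,N_2\le G$ with $\Phi(H)\vartriangleleft N_1\vartriangleleft N_2\vartriangleleft G$. -/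

import Mathlib

/-- Group words over an alphabet `ι` and its formal inverses: the letter `(i, true)` stands for the
generator with index `i` and `(i, false)` for its inverse. -/
abbrev GroupWord (ι : Type*) : Type _ := List (ι × Bool)

/-- The element of `G` represented by a word, when the letter `i` is read as `x i`. -/
def wordValue {ι G : Type*} [Group G] (x : ι → G) (w : GroupWord ι) : G :=
  (w.map fun p => if p.2 then x p.1 else (x p.1)⁻¹).prod

/-- The family `x` generates `G`. -/
def Generates {ι G : Type*} [Group G] (x : ι → G) : Prop :=
  Subgroup.closure (Set.range x) = ⊤

/-- `G` is recursively presented with respect to the generating family `x`: the set of words that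
represent `1` is recursively enumerable. -/
def RecursivelyPresentedWrt {ι G : Type*} [Primcodable ι] [Group G] (x : ι → G) : Prop :=
  REPred fun w : GroupWord ι => wordValue x w = 1

/-- `G` is computable with respect to the generating family `x`: the set of words that
represent `1` is recursive. -/
def ComputableWrt {ι G : Type*} [Primcodable ι] [Group G] (x : ι → G) : Prop :=
  ComputablePred fun w : GroupWord ι => wordValue x w = 1

/-- `G` has a recursive presentation, with respect to some countable generating family
(repetitions are allowed, so that finite generating sets are included). -/
def HasRecursivePresentation (G : Type*) [Group G] : Prop :=
  ∃ g : ℕ → G, Generates g ∧ RecursivelyPresentedWrt g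

/-- `G` has decidable word problem: it is computable with respect to a finite generating family. -/
def HasDecidableWordProblem (G : Type*) [Group G] : Prop :=
  ∃ (n : ℕ) (g : Fin n → G), Generates g ∧ ComputableWrt g

/-- `G` is solvable of derived length `l`. -/
def HasDerivedLength (G : Type*) [Group G] (l : ℕ) : Prop :=
  IsLeast {n : ℕ | derivedSeries G n = ⊥} l

/-- `r` is a left order on `G`: a (reflexive) linear order invariant under left multiplication. -/
def IsLeftOrder {G : Type*} [Group G] (r : G → G → Prop) : Prop :=
  IsLinearOrder G r ∧ ∀ a b c : G, r b c → r (a * b) (a * c)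

/-- `r` is a bi-order on `G`: a left order that is also invariant under right multiplication. -/
def IsBiOrder {G : Type*} [Group G] (r : G → G → Prop) : Prop :=
  IsLeftOrder r ∧ ∀ a b c : G, r b c → r (b * a) (c * a)

/-- The order `r` on `G` is computable with respect to the generating family `x`. -/
def ComputableOrderWrt {ι G : Type*} [Primcodable ι] [Group G] (x : ι → G)
    (r : G → G → Prop) : Prop :=
  ComputablePred fun p : GroupWord ι × GroupWord ι => r (wordValue x p.1) (wordValue x p.2)

/-- The unrestricted iterated wreath product `(H ≀ ℤ) ≀ ℤ`. -/
abbrev DoubleWreath (H : Type*) [Group H] : Type _ :=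
  (H ≀ᵣ Multiplicative ℤ) ≀ᵣ Multiplicative ℤ

/-- The pair `f, s`, as a family of elements of the subgroup `⟨f, s⟩` that it generates. -/
def pairGen {W : Type*} [Group W] (f s : W) : Fin 2 → Subgroup.closure ({f, s} : Set W) :=
  ![⟨f, Subgroup.subset_closure (by simp)⟩, ⟨s, Subgroup.subset_closure (by simp)⟩]

/-! An element of `M ≀ ℤ` is a degree in `ℤ` together with a function `ℤ → M`, its coordinates. In
`H ≀ ℤ` take the generator `t` of `ℤ` and, for each `i`, the function `y_i` equal to `x i` at
positive integers and to `1` elsewhere. In the outer wreath product `s` is the generator of `ℤ` and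
`f` is a function supported on powers of `4`: its value at `1` is `t`, and its value at `4 ^ (encode
i + 1)` is `y_i`.

Powers of `4` have distinct differences and are all `1` mod `3`. A commutator of suitable conjugates
of `f` (`isolator_ofFun`) therefore retains only the coordinate `1`, with value `⁅y_i, t⁆`. This in
turn is `x i` placed at coordinate `1` (`commutator_innerGen`). So `H` embeds at coordinate `(1,
1)`, and the words for the images of its generators are explicit. These words lie in the second
derived subgroup of `G`, which gives the lower bound on derived length; the upper bound comes from
two applications of `derivedSeries_succ_eq_bot`.

For the converse algorithmic statements, a coordinate of a word of length `L` depends only on base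
values within distance `L`. Inside `H ≀ ℤ` those values do not change far to the right. In the outer
group, a window far to the right meets at most one power of `4`, so the coordinate is a power of a
single value of `f`. The exponent can be read off as a degree near position `1`, because `t` has
degree `1` and the other values of `f` have degree `0`. Hence finitely many computable coordinates
decide triviality (`windowDetermined_innerGen`, `windowDetermined_outerGen`), and two such
reductions lead to words over `H`.

Orders extend lexicographically: degree first, then the first coordinate that differs. This is total
on `G` because coordinates far to the left are trivial, and `liftSign` computes it by scanning the
same finite window. Subnormality comes from requiring first the outer degree, then also all inner
degrees, to vanish; what remains acts on the factor at `(1, 1)` by inner automorphisms. -/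

/-! ### The wreath product with the infinite cyclic group -/

/-- The unrestricted wreath product `M ≀ ℤ`. -/
abbrev ZWreath (M : Type*) [Group M] : Type _ := M ≀ᵣ Multiplicative ℤ

namespace ZWreath

open scoped commutatorElement

variable {M N : Type*} [Group M] [Group N]

/-- The image of an element of `M ≀ ℤ` in `ℤ`. -/
def degree (u : ZWreath M) : ℤ := u.right.toAdd

/-- The value at `n` of the base component of an element of `M ≀ ℤ`. -/
def coord (u : ZWreath M) (n : ℤ) : M := u.left (Multiplicative.ofAdd n)

theorem ext_coord {u v : ZWreath M} (hd : degree u = degree v)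
    (hc : ∀ n, coord u n = coord v n) : u = v := by
  apply RegularWreathProduct.ext
  · funext q
    exact hc q.toAdd
  · exact hd

@[simp] theorem degree_one : degree (1 : ZWreath M) = 0 := rfl

@[simp] theorem coord_one (n : ℤ) : coord (1 : ZWreath M) n = 1 := rfl

@[simp] theorem degree_mul (u v : ZWreath M) : degree (u * v) = degree u + degree v := rfl

@[simp] theorem coord_mul (u v : ZWreath M) (n : ℤ) :
    coord (u * v) n = coord u n * coord v (n - degree u) := by
  simp only [coord, degree, RegularWreathProduct.mul_left, Pi.mul_apply]
  congr 2
  rw [sub_eq_neg_add]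
  rfl

@[simp] theorem degree_inv (u : ZWreath M) : degree u⁻¹ = -degree u := rfl

@[simp] theorem coord_inv (u : ZWreath M) (n : ℤ) :
    coord u⁻¹ n = (coord u (n + degree u))⁻¹ := by
  simp only [coord, degree, RegularWreathProduct.inv_left, Pi.inv_apply]
  congr 2
  rw [add_comm]
  rfl

theorem eq_one_iff {u : ZWreath M} : u = 1 ↔ degree u = 0 ∧ ∀ n, coord u n = 1 := by
  constructor
  · rintro rfl
    simp
  · rintro ⟨hd, hc⟩
    exact ext_coord (by simpa using hd) (by simpa using hc)

/-- The degree, as a homomorphism. -/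
def degreeHom (M : Type*) [Group M] : ZWreath M →* Multiplicative ℤ := RegularWreathProduct.rightHom

theorem degreeHom_apply (u : ZWreath M) : degreeHom M u = Multiplicative.ofAdd (degree u) := rfl

/-- The generator of the top group `ℤ`. -/
def shift (M : Type*) [Group M] : ZWreath M := ⟨1, Multiplicative.ofAdd 1⟩

/-- The element of the base group given by a function. -/
def ofFun (F : ℤ → M) : ZWreath M := ⟨fun q => F q.toAdd, 1⟩

@[simp] theorem degree_shift : degree (shift M) = 1 := rfl
@[simp] theorem coord_shift (n : ℤ) : coord (shift M) n = 1 := rfl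
@[simp] theorem degree_ofFun (F : ℤ → M) : degree (ofFun F) = 0 := rfl
@[simp] theorem coord_ofFun (F : ℤ → M) (n : ℤ) : coord (ofFun F) n = F n := rfl

theorem degree_shift_zpow (k : ℤ) : degree (shift M ^ k) = k := by
  have h := map_zpow (degreeHom M) (shift M) k
  have h2 := congrArg Multiplicative.toAdd h
  simpa [degreeHom_apply] using h2

theorem coord_shift_zpow (k n : ℤ) : coord (shift M ^ k) n = 1 := by
  have h := map_zpow (RegularWreathProduct.inl : Multiplicative ℤ →* ZWreath M)
    (Multiplicative.ofAdd 1) k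
  have h2 : (RegularWreathProduct.inl (Multiplicative.ofAdd 1) : ZWreath M) = shift M := rfl
  rw [h2] at h
  rw [← h]
  rfl

/-- The embedding of `M` in `M ≀ ℤ` as the coordinate subgroup at `k`. -/
def single (k : ℤ) : M →* ZWreath M where
  toFun h := ofFun (Pi.mulSingle k h)
  map_one' := by
    apply ext_coord <;> simp
  map_mul' a b := by
    apply ext_coord
    · simp
    · intro n
      simp [Pi.mulSingle_mul]

@[simp] theorem degree_single (k : ℤ) (h : M) : degree (single k h) = 0 := rfl

@[simp] theorem coord_single (k n : ℤ) (h : M) :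
    coord (single k h) n = (Pi.mulSingle k h : ℤ → M) n := rfl

theorem single_injective (k : ℤ) : Function.Injective (single k : M →* ZWreath M) := by
  intro a b hab
  have := congrArg (fun u => coord u k) hab
  simpa using this

/-! ### Derived series -/

/-- One derived step is spent on the degree, which maps to an abelian group. Elements of degree `0`
multiply coordinatewise, so later commutators are taken in each coordinate. -/
theorem derivedSeries_succ_le (k : ℕ) (u : ZWreath M)
    (hu : u ∈ derivedSeries (ZWreath M) (k + 1)) :
    degree u = 0 ∧ ∀ n, coord u n ∈ derivedSeries M k := by
  induction k generalizing u with
  | zero =>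
    refine ⟨?_, fun n => by simp⟩
    have h : derivedSeries (ZWreath M) 1 ≤ (degreeHom M).ker := by
      rw [derivedSeries_one]
      exact Abelianization.commutator_subset_ker _
    have := h hu
    rw [MonoidHom.mem_ker, degreeHom_apply] at this
    exact this
  | succ k ih =>
    let S : Subgroup (ZWreath M) :=
      { carrier := {u | degree u = 0 ∧ ∀ n, coord u n ∈ derivedSeries M (k + 1)}
        one_mem' := by simp [one_mem]
        mul_mem' := by
          rintro a b ⟨ha, ha'⟩ ⟨hb, hb'⟩
          refine ⟨by simp [ha, hb], fun n => ?_⟩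
          rw [coord_mul]
          exact mul_mem (ha' _) (hb' _)
        inv_mem' := by
          rintro a ⟨ha, ha'⟩
          refine ⟨by simp [ha], fun n => ?_⟩
          rw [coord_inv]
          exact inv_mem (ha' _) }
    have h : derivedSeries (ZWreath M) (k + 1 + 1) ≤ S := by
      rw [derivedSeries_succ _ (k + 1), Subgroup.commutator_le]
      intro a ha b hb
      obtain ⟨ha, ha'⟩ := ih a ha
      obtain ⟨hb, hb'⟩ := ih b hb
      refine ⟨by simp [commutatorElement_def, ha, hb], fun n => ?_⟩
      have : coord ⁅a, b⁆ n = ⁅coord a n, coord b n⁆ := by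
        simp [commutatorElement_def, ha, hb]
      rw [this, derivedSeries_succ]
      exact Subgroup.commutator_mem_commutator (ha' n) (hb' n)
    exact h hu

theorem derivedSeries_succ_eq_bot {k : ℕ} (h : derivedSeries M k = ⊥) :
    derivedSeries (ZWreath M) (k + 1) = ⊥ := by
  rw [eq_bot_iff]
  intro u hu
  obtain ⟨hd, hc⟩ := derivedSeries_succ_le k u hu
  rw [h] at hc
  exact eq_one_iff.2 ⟨hd, fun n => by simpa using hc n⟩

/-! ### Lexicographic orders -/

/-- The lexicographic order on `M ≀ ℤ`: compare the degrees first, and then the first coordinates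
that differ. -/
def LexLE (r : M → M → Prop) (u v : ZWreath M) : Prop :=
  u = v ∨ degree u < degree v ∨ degree u = degree v ∧
    ∃ n, (∀ m < n, coord u m = coord v m) ∧ coord u n ≠ coord v n ∧ r (coord u n) (coord v n)

theorem LexLE.refl (r : M → M → Prop) (u : ZWreath M) : LexLE r u u := Or.inl rfl

theorem LexLE.antisymm {r : M → M → Prop} (hr : ∀ a b, r a b → r b a → a = b)
    {u v : ZWreath M} (huv : LexLE r u v) (hvu : LexLE r v u) : u = v := by
  rcases huv with rfl | huv | ⟨hd, n, hn, hne, hrn⟩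
  · rfl
  · rcases hvu with rfl | hvu | ⟨hd', -⟩
    · rfl
    · omega
    · omega
  · rcases hvu with rfl | hvu | ⟨hd', m, hm, hme, hrm⟩
    · rfl
    · omega
    · rcases lt_trichotomy n m with h | rfl | h
      · exact absurd (hm n h).symm hne
      · exact absurd (hr _ _ hrn hrm) hne
      · exact absurd (hn m h).symm hme

theorem LexLE.trans {r : M → M → Prop} (hr : ∀ a b, r a b → r b a → a = b)
    (ht : ∀ a b c, r a b → r b c → r a c)
    {u v w : ZWreath M} (huv : LexLE r u v) (hvw : LexLE r v w) : LexLE r u w := by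
  rcases huv with rfl | huv | ⟨hd, n, hn, hne, hrn⟩
  · exact hvw
  · rcases hvw with rfl | hvw | ⟨hd', -⟩
    · exact Or.inr (Or.inl huv)
    · exact Or.inr (Or.inl (by omega))
    · exact Or.inr (Or.inl (by omega))
  · rcases hvw with rfl | hvw | ⟨hd', m, hm, hme, hrm⟩
    · exact Or.inr (Or.inr ⟨hd, n, hn, hne, hrn⟩)
    · exact Or.inr (Or.inl (by omega))
    · refine Or.inr (Or.inr ⟨by omega, ?_⟩)
      rcases lt_trichotomy n m with h | rfl | h
      · refine ⟨n, fun k hk => (hn k hk).trans (hm k (hk.trans h)), ?_, ?_⟩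
        · rwa [← hm n h]
        · rwa [← hm n h]
      · refine ⟨n, fun k hk => (hn k hk).trans (hm k hk), ?_, ht _ _ _ hrn hrm⟩
        -- Equality of the outer two values would force the middle one to equal them, by
        -- antisymmetry.
        intro h
        rw [← h] at hrm
        exact hne (hr _ _ hrn hrm)
      · refine ⟨m, fun k hk => (hn k (hk.trans h)).trans (hm k hk), ?_, ?_⟩
        · rwa [hn m h]
        · rwa [hn m h]

theorem LexLE.mul_left {r : M → M → Prop} (hr : ∀ a b c, r b c → r (a * b) (a * c))
    (a : ZWreath M) {u v : ZWreath M} (huv : LexLE r u v) : LexLE r (a * u) (a * v) := by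
  rcases huv with rfl | huv | ⟨hd, n, hn, hne, hrn⟩
  · exact Or.inl rfl
  · exact Or.inr (Or.inl (by simpa using huv))
  · refine Or.inr (Or.inr ⟨by simpa using hd, n + degree a, fun m hm => ?_, ?_, ?_⟩)
    · simp [hn (m - degree a) (by omega)]
    · simpa using hne
    · simpa using hr _ _ _ hrn

theorem LexLE.mul_right {r : M → M → Prop} (hr : ∀ a b c, r b c → r (b * a) (c * a))
    (a : ZWreath M) {u v : ZWreath M} (huv : LexLE r u v) : LexLE r (u * a) (v * a) := by
  rcases huv with rfl | huv | ⟨hd, n, hn, hne, hrn⟩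
  · exact Or.inl rfl
  · exact Or.inr (Or.inl (by simpa using huv))
  · refine Or.inr (Or.inr ⟨by simpa using hd, n, fun m hm => ?_, ?_, ?_⟩)
    · simp [hn m hm, hd]
    · simpa [hd] using hne
    · simpa [hd] using hr _ _ _ hrn

theorem lexLE_single {r : M → M → Prop} (hr : ∀ a, r a a) (k : ℤ) (a b : M) :
    LexLE r (single k a) (single k b) ↔ r a b := by
  constructor
  · rintro (h | h | ⟨-, n, -, hne, hrn⟩)
    · rw [single_injective k h]
      exact hr b
    · simp at h
    · have hnk : n = k := by
        by_contra hnk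
        simp [Pi.mulSingle_eq_of_ne hnk] at hne
      subst hnk
      simpa using hrn
  · intro h
    by_cases hab : a = b
    · subst hab
      exact Or.inl rfl
    · refine Or.inr (Or.inr ⟨by simp, k, fun m hm => ?_, by simpa using hab, by simpa using h⟩)
      simp [Pi.mulSingle_eq_of_ne hm.ne]

end ZWreath

/-! ### Words -/

section Words

variable {ι κ G K : Type*} [Group G] [Group K]

@[simp] theorem wordValue_nil (x : ι → G) : wordValue x [] = 1 := rfl

theorem wordValue_cons (x : ι → G) (p : ι × Bool) (w : GroupWord ι) :
    wordValue x (p :: w) = (if p.2 then x p.1 else (x p.1)⁻¹) * wordValue x w := by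
  simp [wordValue]

@[simp] theorem wordValue_append (x : ι → G) (v w : GroupWord ι) :
    wordValue x (v ++ w) = wordValue x v * wordValue x w := by
  simp [wordValue]

theorem wordValue_singleton (x : ι → G) (i : ι) (b : Bool) :
    wordValue x [(i, b)] = if b then x i else (x i)⁻¹ := by
  simp [wordValue]

theorem wordValue_replicate (x : ι → G) (p : ι × Bool) (n : ℕ) :
    wordValue x (List.replicate n p) = (if p.2 then x p.1 else (x p.1)⁻¹) ^ n := by
  simp [wordValue]

theorem map_wordValue (φ : G →* K) (x : ι → G) (w : GroupWord ι) :
    φ (wordValue x w) = wordValue (fun i => φ (x i)) w := by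
  induction w with
  | nil => simp
  | cons p w ih =>
    rw [wordValue_cons, wordValue_cons, map_mul, ih]
    split <;> simp

/-- The formal inverse of a word. -/
def invWord (w : GroupWord ι) : GroupWord ι := (w.map fun p => (p.1, !p.2)).reverse

@[simp] theorem wordValue_invWord (x : ι → G) (w : GroupWord ι) :
    wordValue x (invWord w) = (wordValue x w)⁻¹ := by
  induction w with
  | nil => simp [invWord]
  | cons p w ih =>
    have h : invWord (p :: w) = invWord w ++ [(p.1, !p.2)] := by simp [invWord]
    rw [h, wordValue_append, ih, wordValue_singleton, wordValue_cons, mul_inv_rev]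
    rcases p with ⟨i, _ | _⟩ <;> simp

/-- Substitution of words for the letters of a word. -/
def substWord (s : ι → GroupWord κ) (w : GroupWord ι) : GroupWord κ :=
  w.flatMap fun p => bif p.2 then s p.1 else invWord (s p.1)

theorem wordValue_substWord (g : κ → G) (s : ι → GroupWord κ) (w : GroupWord ι) :
    wordValue g (substWord s w) = wordValue (fun i => wordValue g (s i)) w := by
  induction w with
  | nil => simp [substWord]
  | cons p w ih =>
    have h : substWord s (p :: w) =
        (bif p.2 then s p.1 else invWord (s p.1)) ++ substWord s w := by simp [substWord]
    rw [h, wordValue_append, ih, wordValue_cons]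
    rcases p with ⟨i, _ | _⟩ <;> simp

theorem Generates.exists_word {x : ι → G} (hx : Generates x) (g : G) :
    ∃ w, wordValue x w = g := by
  have hg : g ∈ Subgroup.closure (Set.range x) := by
    rw [hx]
    trivial
  induction hg using Subgroup.closure_induction with
  | mem y hy =>
    obtain ⟨i, rfl⟩ := hy
    exact ⟨[(i, true)], by simp [wordValue_singleton]⟩
  | one => exact ⟨[], rfl⟩
  | mul y z _ _ hy hz =>
    obtain ⟨v, rfl⟩ := hy
    obtain ⟨w, rfl⟩ := hz
    exact ⟨v ++ w, by simp⟩
  | inv y _ hy =>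
    obtain ⟨v, rfl⟩ := hy
    exact ⟨invWord v, by simp⟩

theorem primrec_invWord [Primcodable ι] : Primrec (invWord : GroupWord ι → GroupWord ι) :=
  Primrec.list_reverse.comp (Primrec.list_map Primrec.id
    ((Primrec.fst.comp Primrec.snd).pair (Primrec.not.comp (Primrec.snd.comp Primrec.snd))).to₂)

theorem primrec_substWord [Primcodable ι] [Primcodable κ] {s : ι → GroupWord κ}
    (hs : Primrec s) : Primrec (substWord s) := by
  have h : Primrec fun q : GroupWord ι × (ι × Bool) => s q.2.1 :=
    hs.comp (Primrec.fst.comp Primrec.snd)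
  exact Primrec.list_flatMap Primrec.id
    (Primrec.cond (Primrec.snd.comp Primrec.snd) h (primrec_invWord.comp h)).to₂

/-! ### Transfer of algorithmic properties between generating families. -/

theorem ComputablePred.comp_computable {α β : Type*} [Primcodable α] [Primcodable β] {p : β → Prop}
    (hp : ComputablePred p) {f : α → β} (hf : Computable f) : ComputablePred fun a => p (f a) :=
  ComputablePred.computable_of_manyOneReducible ⟨f, hf, fun _ => Iff.rfl⟩ hp

theorem REPred.comp_computable {α β : Type*} [Primcodable α] [Primcodable β] {p : β → Prop}
    (hp : REPred p) {f : α → β} (hf : Computable f) : REPred fun a => p (f a) :=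
  Partrec.comp hp hf

theorem wordValue_eq_one_iff_of_subst (φ : K →* G) (hφ : Function.Injective φ)
    {g : κ → G} {x : ι → K} {s : ι → GroupWord κ} (h : ∀ i, wordValue g (s i) = φ (x i))
    (w : GroupWord ι) : wordValue g (substWord s w) = 1 ↔ wordValue x w = 1 := by
  rw [wordValue_substWord]
  simp only [h]
  rw [← map_wordValue, map_eq_one_iff φ hφ]

/-- Computability passes to a family of elements given by computable words. -/
theorem ComputableWrt.of_subst [Primcodable ι] [Primcodable κ] (φ : K →* G)
    (hφ : Function.Injective φ) {g : κ → G} {x : ι → K} {s : ι → GroupWord κ} (hs : Primrec s)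
    (h : ∀ i, wordValue g (s i) = φ (x i)) (hg : ComputableWrt g) : ComputableWrt x :=
  (ComputablePred.comp_computable hg (primrec_substWord hs).to_comp).of_eq
    (wordValue_eq_one_iff_of_subst φ hφ h)

/-- Recursive enumerability passes to a family of elements given by computable words. -/
theorem RecursivelyPresentedWrt.of_subst [Primcodable ι] [Primcodable κ] (φ : K →* G)
    (hφ : Function.Injective φ) {g : κ → G} {x : ι → K} {s : ι → GroupWord κ} (hs : Primrec s)
    (h : ∀ i, wordValue g (s i) = φ (x i)) (hg : RecursivelyPresentedWrt g) :
    RecursivelyPresentedWrt x :=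
  (REPred.comp_computable hg (primrec_substWord hs).to_comp).of_eq
    (wordValue_eq_one_iff_of_subst φ hφ h)

end Words

/-! ### Words over the generators of a subgroup of `M ≀ ℤ` -/

section Coord

variable {A B M N : Type*} [Group M] [Group N]

open ZWreath

/-- The family consisting of the generator of `ℤ` and of base elements. -/
def baseGen (F : A → ℤ → M) : Option A → ZWreath M
  | none => shift M
  | some a => ofFun (F a)

/-- Each letter moves the position being read by at most one, so the coordinate at `n` is a product
of base values within distance `w.length`. Allowing a translation `d` and a homomorphism `φ` lets
one lemma cover vanishing, translation invariance, powers of a single value, and degrees. -/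
theorem coord_wordValue_congr (φ : N →* M) {F : A → ℤ → M} {F' : A → ℤ → N} (d : ℤ)
    (w : GroupWord (Option A)) (n : ℤ)
    (h : ∀ a p, n - w.length ≤ p → p ≤ n + w.length → F a p = φ (F' a (p + d))) :
    coord (wordValue (baseGen F) w) n = φ (coord (wordValue (baseGen F') w) (n + d)) := by
  induction w generalizing n with
  | nil => simp
  | cons q w ih =>
    rw [wordValue_cons, wordValue_cons]
    simp only [List.length_cons, Nat.cast_add, Nat.cast_one] at h
    rcases q with ⟨_ | a, _ | _⟩
    · have := ih (n + 1) (fun a p h1 h2 => h a p (by omega) (by omega))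
      simp [baseGen, this, add_right_comm]
    · have := ih (n - 1) (fun a p h1 h2 => h a p (by omega) (by omega))
      simp [baseGen, this, sub_add_eq_add_sub]
    · have := ih n (fun a p h1 h2 => h a p (by omega) (by omega))
      simp [baseGen, this, h a n (by omega) (by omega)]
    · have := ih n (fun a p h1 h2 => h a p (by omega) (by omega))
      simp [baseGen, this, h a n (by omega) (by omega)]

theorem coord_wordValue_eq_one {F : A → ℤ → M} (w : GroupWord (Option A)) (n : ℤ)
    (h : ∀ a p, n - w.length ≤ p → p ≤ n + w.length → F a p = 1) :
    coord (wordValue (baseGen F) w) n = 1 :=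
  coord_wordValue_congr (1 : M →* M) (F' := F) 0 w n h

/-- Base elements whose values are looked up in a family `g`, by a function that depends on
positive positions only. -/
def lookupFun (ℓ : A → ℕ → Option B) (g : B → M) (a : A) (n : ℤ) : M :=
  (ℓ a n.toNat).elim 1 g

/-- Positions in `ℤ` are represented by pairs of natural numbers, standing for their difference.
This is the position after reading a letter. -/
def posStep (q : Option A × Bool) (p : ℕ × ℕ) : ℕ × ℕ :=
  q.1.elim (bif q.2 then (p.1, p.2 + 1) else (p.1 + 1, p.2)) fun _ => p

/-- The letter of the coordinate word that a letter contributes at a given position. -/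
def emitLetter (ℓ : A → ℕ → Option B) (q : Option A × Bool) (p : ℕ × ℕ) : GroupWord B :=
  (q.1.bind fun a => (ℓ a (p.1 - p.2)).map fun b => (b, q.2)).toList

/-- The position after reading a word. -/
def endPos (w : GroupWord (Option A)) (p : ℕ × ℕ) : ℕ × ℕ := w.foldl (fun p q => posStep q p) p

/-- A word that represents a coordinate of the element represented by a given word. -/
def coordWord (ℓ : A → ℕ → Option B) : GroupWord (Option A) → ℕ × ℕ → GroupWord B
  | [], _ => []
  | q :: w, p => emitLetter ℓ q p ++ coordWord ℓ w (posStep q p)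

theorem wordValue_coordWord (ℓ : A → ℕ → Option B) (g : B → M) (w : GroupWord (Option A))
    (p : ℕ × ℕ) : wordValue g (coordWord ℓ w p) =
      coord (wordValue (baseGen (lookupFun ℓ g)) w) ((p.1 : ℤ) - p.2) := by
  induction w generalizing p with
  | nil => simp [coordWord]
  | cons q w ih =>
    rw [coordWord, wordValue_append, ih, wordValue_cons]
    have ht : ((p.1 : ℤ) - p.2).toNat = p.1 - p.2 := by omega
    rcases q with ⟨_ | a, _ | _⟩
    · simp [baseGen, posStep, emitLetter, add_sub_right_comm]
    · simp [baseGen, posStep, emitLetter, sub_add_eq_sub_sub]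
    · rcases h : ℓ a (p.1 - p.2) with _ | b <;>
        simp [baseGen, posStep, emitLetter, lookupFun, ht, h, wordValue_singleton]
    · rcases h : ℓ a (p.1 - p.2) with _ | b <;>
        simp [baseGen, posStep, emitLetter, lookupFun, ht, h, wordValue_singleton]

/-- Reading the generator of `ℤ` lowers the position by one, so the degree is the total drop in
position; it depends on the word alone. -/
theorem endPos_sub (F : A → ℤ → M) (w : GroupWord (Option A)) (p : ℕ × ℕ) :
    ((endPos w p).2 : ℤ) - (endPos w p).1 =
      p.2 - p.1 + degree (wordValue (baseGen F) w) := by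
  induction w generalizing p with
  | nil => simp [endPos]
  | cons q w ih =>
    have h : endPos (q :: w) p = endPos w (posStep q p) := rfl
    rw [h, ih, wordValue_cons]
    rcases q with ⟨_ | a, _ | _⟩ <;> simp [baseGen, posStep] <;> ring

/-- Carrying the current position and the output as state turns the recursion into a left fold, the
form needed for primitive recursiveness. -/
theorem foldl_coordWord (ℓ : A → ℕ → Option B) (w : GroupWord (Option A)) (p : ℕ × ℕ)
    (v : GroupWord B) :
    w.foldl (fun s q => (posStep q s.1, s.2 ++ emitLetter ℓ q s.1)) (p, v) =
      (endPos w p, v ++ coordWord ℓ w p) := by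
  induction w generalizing p v with
  | nil => simp [endPos, coordWord]
  | cons q w ih =>
    rw [List.foldl_cons, ih, coordWord, List.append_assoc]
    rfl

section Primrec

variable [Primcodable A] [Primcodable B]

theorem primrec_posStep : Primrec₂ (posStep : Option A × Bool → ℕ × ℕ → ℕ × ℕ) := by
  have h : Primrec fun x : (Option A × Bool) × ℕ × ℕ =>
      (bif x.1.2 then (x.2.1, x.2.2 + 1) else (x.2.1 + 1, x.2.2) : ℕ × ℕ) :=
    Primrec.cond (Primrec.snd.comp Primrec.fst)
      ((Primrec.fst.comp Primrec.snd).pair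
        (Primrec.succ.comp (Primrec.snd.comp Primrec.snd)))
      ((Primrec.succ.comp (Primrec.fst.comp Primrec.snd)).pair
        (Primrec.snd.comp Primrec.snd))
  refine (Primrec.option_casesOn (Primrec.fst.comp Primrec.fst) h
    ((Primrec.snd.comp Primrec.fst).to₂)).of_eq fun x => ?_
  rcases x with ⟨⟨_ | a, b⟩, p⟩ <;> rfl

theorem primrec_emitLetter {ℓ : A → ℕ → Option B} (hℓ : Primrec₂ ℓ) :
    Primrec₂ (emitLetter ℓ) := by
  refine Primrec.optionToList.comp (Primrec.option_bind (Primrec.fst.comp Primrec.fst) ?_)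
  refine Primrec.option_map (hℓ.comp Primrec.snd (Primrec.nat_sub.comp
    (Primrec.fst.comp (Primrec.snd.comp Primrec.fst))
    (Primrec.snd.comp (Primrec.snd.comp Primrec.fst)))) ?_
  exact Primrec.snd.pair
    (Primrec.snd.comp (Primrec.fst.comp (Primrec.fst.comp Primrec.fst)))

theorem primrec_endPos : Primrec₂ (endPos : GroupWord (Option A) → ℕ × ℕ → ℕ × ℕ) :=
  Primrec.list_foldl Primrec.fst Primrec.snd
    (primrec_posStep.comp (Primrec.snd.comp Primrec.snd) (Primrec.fst.comp Primrec.snd)).to₂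

theorem primrec_coordWord {ℓ : A → ℕ → Option B} (hℓ : Primrec₂ ℓ) :
    Primrec₂ (coordWord ℓ) := by
  have hs : Primrec fun y : (GroupWord (Option A) × ℕ × ℕ) ×
      (((ℕ × ℕ) × GroupWord B) × Option A × Bool) => y.2.1.1 :=
    Primrec.fst.comp (Primrec.fst.comp Primrec.snd)
  have hq : Primrec fun y : (GroupWord (Option A) × ℕ × ℕ) ×
      (((ℕ × ℕ) × GroupWord B) × Option A × Bool) => y.2.2 :=
    Primrec.snd.comp Primrec.snd
  have h : Primrec fun x : GroupWord (Option A) × ℕ × ℕ =>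
      x.1.foldl (fun s q => (posStep q s.1, s.2 ++ emitLetter ℓ q s.1))
        ((x.2, []) : (ℕ × ℕ) × GroupWord B) :=
    Primrec.list_foldl (g := fun x => (x.2, []))
      (h := fun _ y => (posStep y.2 y.1.1, y.1.2 ++ emitLetter ℓ y.2 y.1.1))
      Primrec.fst (Primrec.snd.pair (Primrec.const []))
      ((primrec_posStep.comp hq hs).pair (Primrec.list_append.comp
        (Primrec.snd.comp (Primrec.fst.comp Primrec.snd)) ((primrec_emitLetter hℓ).comp hq hs)))
  exact (Primrec.snd.comp h).of_eq fun x => by rw [foldl_coordWord]; rfl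

end Primrec

end Coord

/-! ### Deciding signs in a subgroup of `M ≀ ℤ` coordinate by coordinate -/

section LiftSign

variable {A B M : Type*} [Group M]

open ZWreath

/-- A family of elements of `M ≀ ℤ` is window determined if the elements represented by a word of
length `L` vanish at the coordinates below `-L`, and vanish everywhere as soon as they vanish at the
coordinates from `-L` to `3 * L + 1`. -/
def WindowDetermined (u : A → ZWreath M) : Prop :=
  ∀ w : GroupWord A, (∀ n : ℤ, n < -w.length → coord (wordValue u w) n = 1) ∧
    ((∀ n : ℤ, -w.length ≤ n → n ≤ 3 * w.length + 1 → coord (wordValue u w) n = 1) →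
      ∀ n, coord (wordValue u w) n = 1)

/-- The sign of the element of `M ≀ ℤ` represented by a word, computed from a sign function on words
for `M`; `none` stands for the identity, `some true` for positive. -/
def liftSign (ℓ : A → ℕ → Option B) (σ : GroupWord B → Option Bool)
    (w : GroupWord (Option A)) : Option Bool :=
  bif decide ((endPos w (0, 0)).1 < (endPos w (0, 0)).2) then some true
  else bif decide ((endPos w (0, 0)).2 < (endPos w (0, 0)).1) then some false
  else (List.range (4 * w.length + 2)).findSome? fun j => σ (coordWord ℓ w (j, w.length))

theorem findSome?_range_eq_some {β : Type*} (f : ℕ → Option β) (N : ℕ) (b : β) :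
    (List.range N).findSome? f = some b ↔ ∃ j < N, f j = some b ∧ ∀ i < j, f i = none := by
  induction N with
  | zero => simp
  | succ N ih =>
    rw [List.range_succ, List.findSome?_append, Option.or_eq_some_iff, ih,
      List.findSome?_eq_none_iff]
    constructor
    · rintro (⟨j, hj, h⟩ | ⟨h, h'⟩)
      · exact ⟨j, by omega, h⟩
      · exact ⟨N, by omega, by simpa using h', fun i hi => h i (by simpa using hi)⟩
    · rintro ⟨j, hj, h, h'⟩
      rcases Nat.lt_succ_iff_lt_or_eq.1 hj with hj | rfl
      · exact Or.inl ⟨j, hj, h, h'⟩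
      · exact Or.inr ⟨fun i hi => h' i (by simpa using hi), by simpa using h⟩

variable {ℓ : A → ℕ → Option B} {g : B → M}

theorem liftSign_of_degree_pos {σ : GroupWord B → Option Bool} {w : GroupWord (Option A)}
    (h : 0 < degree (wordValue (baseGen (lookupFun ℓ g)) w)) : liftSign ℓ σ w = some true := by
  have := endPos_sub (lookupFun ℓ g) w (0, 0)
  have h1 : (endPos w (0, 0)).1 < (endPos w (0, 0)).2 := by
    simp only [Nat.cast_zero] at this
    omega
  simp [liftSign, h1]

theorem liftSign_of_degree_neg {σ : GroupWord B → Option Bool} {w : GroupWord (Option A)}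
    (h : degree (wordValue (baseGen (lookupFun ℓ g)) w) < 0) : liftSign ℓ σ w = some false := by
  have := endPos_sub (lookupFun ℓ g) w (0, 0)
  have h1 : (endPos w (0, 0)).2 < (endPos w (0, 0)).1 := by
    simp only [Nat.cast_zero] at this
    omega
  simp [liftSign, h1, h1.not_gt]

theorem liftSign_of_degree_zero {σ : GroupWord B → Option Bool} {w : GroupWord (Option A)}
    (h : degree (wordValue (baseGen (lookupFun ℓ g)) w) = 0) : liftSign ℓ σ w =
      (List.range (4 * w.length + 2)).findSome? fun j => σ (coordWord ℓ w (j, w.length)) := by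
  have := endPos_sub (lookupFun ℓ g) w (0, 0)
  have h1 : (endPos w (0, 0)).1 = (endPos w (0, 0)).2 := by
    simp only [Nat.cast_zero] at this
    omega
  simp [liftSign, h1]

theorem liftSign_eq_none {σ : GroupWord B → Option Bool} {w : GroupWord (Option A)} :
    liftSign ℓ σ w = none ↔ degree (wordValue (baseGen (lookupFun ℓ g)) w) = 0 ∧
      ∀ j < 4 * w.length + 2, σ (coordWord ℓ w (j, w.length)) = none := by
  rcases lt_trichotomy 0 (degree (wordValue (baseGen (lookupFun ℓ g)) w)) with h | h | h
  · simp [liftSign_of_degree_pos h, h.ne']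
  · rw [liftSign_of_degree_zero h.symm]
    simp [h.symm]
  · simp [liftSign_of_degree_neg h, h.ne]

theorem liftSign_eq_none_mono {σ τ : GroupWord B → Option Bool}
    (h : ∀ c, σ c = none → τ c = none) {w : GroupWord (Option A)}
    (hw : liftSign ℓ σ w = none) : liftSign ℓ τ w = none := by
  -- `liftSign` does not involve `g`; any group serves to name the degree.
  rw [liftSign_eq_none (g := fun _ => (1 : Multiplicative ℤ))] at hw ⊢
  exact ⟨hw.1, fun j hj => h _ (hw.2 j hj)⟩

theorem WindowDetermined.eq_one_iff (hu : WindowDetermined (baseGen (lookupFun ℓ g)))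
    (w : GroupWord (Option A)) : wordValue (baseGen (lookupFun ℓ g)) w = 1 ↔
      degree (wordValue (baseGen (lookupFun ℓ g)) w) = 0 ∧
        ∀ j < 4 * w.length + 2, wordValue g (coordWord ℓ w (j, w.length)) = 1 := by
  constructor
  · intro h
    rw [ZWreath.eq_one_iff] at h
    exact ⟨h.1, fun j _ => by rw [wordValue_coordWord, h.2]⟩
  · rintro ⟨hd, h⟩
    refine ZWreath.eq_one_iff.2 ⟨hd, (hu w).2 fun n h1 h2 => ?_⟩
    -- The index `j` stands for the coordinate `j - w.length`, so `4 * w.length + 2` indices cover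
    -- the whole window.
    have := h (n + w.length).toNat (by omega)
    rw [wordValue_coordWord] at this
    convert this using 2
    simp only
    omega

/-- Triviality is a conjunction of finitely many conditions on coordinates, each confirmed at some
stage. Monotonicity allows the maximum of these stages to confirm all of them at once. -/
theorem wordValue_eq_one_iff_exists_liftSign (hu : WindowDetermined (baseGen (lookupFun ℓ g)))
    {σ : ℕ → GroupWord B → Option Bool}
    (hmono : ∀ s t, s ≤ t → ∀ c, σ s c = none → σ t c = none)
    (hσ : ∀ c, wordValue g c = 1 ↔ ∃ t, σ t c = none) (w : GroupWord (Option A)) :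
    wordValue (baseGen (lookupFun ℓ g)) w = 1 ↔ ∃ t, liftSign ℓ (σ t) w = none := by
  rw [hu.eq_one_iff]
  simp only [liftSign_eq_none (g := g), hσ]
  constructor
  · rintro ⟨hd, h⟩
    have : ∀ N, (∀ j < N, ∃ t, σ t (coordWord ℓ w (j, w.length)) = none) →
        ∃ t, ∀ j < N, σ t (coordWord ℓ w (j, w.length)) = none := by
      intro N
      induction N with
      | zero => simp
      | succ N ih =>
        intro hN
        obtain ⟨t, ht⟩ := ih fun j hj => hN j (by omega)
        obtain ⟨s, hs⟩ := hN N (by omega)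
        refine ⟨max s t, fun j hj => ?_⟩
        rcases Nat.lt_succ_iff_lt_or_eq.1 hj with hj | rfl
        · exact hmono _ _ (le_max_right _ _) _ (ht j hj)
        · exact hmono _ _ (le_max_left _ _) _ hs
    obtain ⟨t, ht⟩ := this _ h
    exact ⟨t, hd, ht⟩
  · rintro ⟨t, hd, h⟩
    exact ⟨hd, fun j hj => ⟨t, h j hj⟩⟩

/-- `σ` computes the signs of the elements represented by words, with respect to the order `r`. -/
def IsSignFor (r : M → M → Prop) (x : B → M) (σ : GroupWord B → Option Bool) : Prop :=
  ∀ c, (σ c = none ↔ wordValue x c = 1) ∧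
    (σ c = some true ↔ wordValue x c ≠ 1 ∧ r 1 (wordValue x c))

theorem IsSignFor.lift (hu : WindowDetermined (baseGen (lookupFun ℓ g)))
    {r : M → M → Prop} {σ : GroupWord B → Option Bool} (hσ : IsSignFor r g σ) :
    IsSignFor (LexLE r) (baseGen (lookupFun ℓ g)) (liftSign ℓ σ) := by
  intro w
  have hnone : liftSign ℓ σ w = none ↔ wordValue (baseGen (lookupFun ℓ g)) w = 1 := by
    rw [hu.eq_one_iff, liftSign_eq_none (g := g)]
    simp only [(hσ _).1]
  refine ⟨hnone, ?_⟩
  rcases lt_trichotomy 0 (degree (wordValue (baseGen (lookupFun ℓ g)) w)) with h | h | h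
  · rw [liftSign_of_degree_pos h]
    refine iff_of_true rfl ⟨?_, Or.inr (Or.inl (by simpa using h))⟩
    intro h1
    simp [h1] at h
  · rw [liftSign_of_degree_zero h.symm, findSome?_range_eq_some]
    simp only [(hσ _).1, (hσ _).2, wordValue_coordWord]
    constructor
    · rintro ⟨j, hj, ⟨hne, hr⟩, hlt⟩
      refine ⟨fun h1 => hne (by simp [h1]), Or.inr (Or.inr ⟨by simpa using h,
        (j : ℤ) - w.length, fun m hm => ?_, by simpa using hne.symm, by simpa using hr⟩)⟩
      rw [coord_one]
      by_cases hm' : m < -w.length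
      · exact ((hu w).1 m hm').symm
      · rw [← hlt (m + w.length).toNat (by omega)]
        congr 1
        omega
    · rintro ⟨hne, h1 | h1 | ⟨-, n, hlt, hn, hr⟩⟩
      · exact absurd h1.symm hne
      · simp [← h] at h1
      · simp only [coord_one] at hlt hn hr
        have hn1 : -w.length ≤ n := by
          by_contra hn1
          exact hn ((hu w).1 n (by omega)).symm
        -- A first nontrivial coordinate beyond the window would leave the window trivial, forcing
        -- all coordinates to be trivial.
        have hn2 : n ≤ 3 * w.length + 1 := by
          by_contra hn2
          exact hn ((hu w).2 (fun m _ hm => (hlt m (by omega)).symm) n).symm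
        have hnn : (((n + w.length).toNat : ℕ) : ℤ) - w.length = n := by omega
        refine ⟨(n + w.length).toNat, by omega, ?_, fun i hi => ?_⟩
        · simp only [hnn]
          exact ⟨Ne.symm hn, hr⟩
        · exact (hlt _ (by omega)).symm
  · rw [liftSign_of_degree_neg h]
    refine iff_of_false (by simp) ?_
    rintro ⟨hne, h1 | h1 | ⟨h1, -⟩⟩
    · exact hne h1.symm
    · simp only [degree_one] at h1
      omega
    · simp only [degree_one] at h1
      omega

/-- The order `r` compares the elements represented by words with the identity. -/
def ComparableWithOne {C M : Type*} [Group M] (r : M → M → Prop) (x : C → M) : Prop :=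
  ∀ w, r 1 (wordValue x w) ∨ r (wordValue x w) 1

/-- A function on `ℤ` need not have a first nontrivial value, so the lexicographic order is not
total on the full wreath product. For elements given by words, triviality far to the left supplies
one, and its value is again given by a word, so the hypothesis on `r` applies to it. -/
theorem ComparableWithOne.lexLE (hu : WindowDetermined (baseGen (lookupFun ℓ g)))
    {r : M → M → Prop} (hr : ComparableWithOne r g) :
    ComparableWithOne (LexLE r) (baseGen (lookupFun ℓ g)) := by
  intro w
  rcases lt_trichotomy 0 (degree (wordValue (baseGen (lookupFun ℓ g)) w)) with h | h | h
  · exact Or.inl (Or.inr (Or.inl (by simpa using h)))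
  · by_cases h1 : wordValue (baseGen (lookupFun ℓ g)) w = 1
    · exact Or.inl (Or.inl h1.symm)
    have hex : ∃ n, coord (wordValue (baseGen (lookupFun ℓ g)) w) n ≠ 1 := by
      by_contra! hall
      exact h1 (ZWreath.eq_one_iff.2 ⟨h.symm, hall⟩)
    obtain ⟨n, hn, hmin⟩ := Int.exists_least_of_bdd
      (P := fun n => coord (wordValue (baseGen (lookupFun ℓ g)) w) n ≠ 1)
      ⟨-w.length, fun z hz => by
        by_contra hlt
        exact hz ((hu w).1 z (by omega))⟩ hex
    have hlt : ∀ m < n, coord (wordValue (baseGen (lookupFun ℓ g)) w) m = 1 := by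
      intro m hm
      by_contra hm1
      exact absurd (hmin m hm1) (by omega)
    have hcw := wordValue_coordWord ℓ g w (n.toNat, (-n).toNat)
    have hnn : ((n.toNat : ℕ) : ℤ) - ((-n).toNat : ℕ) = n := by omega
    simp only [hnn] at hcw
    rcases hr (coordWord ℓ w (n.toNat, (-n).toNat)) with hr | hr
    · rw [hcw] at hr
      exact Or.inl (Or.inr (Or.inr ⟨by simpa using h, n, fun m hm => by simp [hlt m hm],
        by simpa using Ne.symm hn, by simpa using hr⟩))
    · rw [hcw] at hr
      exact Or.inr (Or.inr (Or.inr ⟨by simpa using h.symm, n, fun m hm => by simp [hlt m hm],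
        by simpa using hn, by simpa using hr⟩))
  · exact Or.inr (Or.inr (Or.inl (by simpa using h)))

/-! ### Computability of the lifted sign. -/

theorem computable_findSome?_range {α β : Type*} [Primcodable α] [Primcodable β] {N : α → ℕ}
    {f : α → ℕ → Option β} (hN : Computable N) (hf : Computable₂ f) :
    Computable fun a => (List.range (N a)).findSome? (f a) := by
  have hstep : Computable₂ fun a (p : ℕ × Option β) =>
      (p.2.casesOn (f a p.1) some : Option β) :=
    Computable.option_casesOn (Computable.snd.comp Computable.snd)
      (hf.comp Computable.fst (Computable.fst.comp Computable.snd))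
      (Computable.option_some.comp Computable.snd).to₂
  have h := Computable.nat_rec hN (Computable.const (none : Option β)) hstep
  refine h.of_eq fun a => ?_
  induction N a with
  | zero => simp
  | succ n ih =>
    simp only [ih, List.range_succ, List.findSome?_append]
    rcases (List.range n).findSome? (f a) with _ | b <;> simp

theorem computable_liftSign {T : Type*} [Primcodable A] [Primcodable B] [Primcodable T]
    (hℓ : Primrec₂ ℓ) {σ : T → GroupWord B → Option Bool} (hσ : Computable₂ σ) :
    Computable₂ fun t w => liftSign ℓ (σ t) w := by
  have he : Primrec fun x : T × GroupWord (Option A) => endPos x.2 (0, 0) :=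
    primrec_endPos.comp Primrec.snd (Primrec.const (0, 0))
  have hL : Primrec fun x : T × GroupWord (Option A) => x.2.length :=
    Primrec.list_length.comp Primrec.snd
  have h1 : Primrec fun x : T × GroupWord (Option A) =>
      decide ((endPos x.2 (0, 0)).1 < (endPos x.2 (0, 0)).2) :=
    (Primrec.nat_lt.comp (Primrec.fst.comp he) (Primrec.snd.comp he)).decide
  have h2 : Primrec fun x : T × GroupWord (Option A) =>
      decide ((endPos x.2 (0, 0)).2 < (endPos x.2 (0, 0)).1) :=
    (Primrec.nat_lt.comp (Primrec.snd.comp he) (Primrec.fst.comp he)).decide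
  have hN : Primrec fun x : T × GroupWord (Option A) => 4 * x.2.length + 2 :=
    Primrec.nat_add.comp (Primrec.nat_mul.comp (Primrec.const 4) hL) (Primrec.const 2)
  have hc : Primrec fun y : (T × GroupWord (Option A)) × ℕ =>
      coordWord ℓ y.1.2 (y.2, y.1.2.length) :=
    (primrec_coordWord hℓ).comp (Primrec.snd.comp Primrec.fst)
      (Primrec.snd.pair (hL.comp Primrec.fst))
  exact Computable.cond h1.to_comp (Computable.const _) (Computable.cond h2.to_comp
    (Computable.const _) (computable_findSome?_range hN.to_comp
      (hσ.comp (Computable.fst.comp Computable.fst) hc.to_comp)))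

end LiftSign

/-! ### The two generators -/

section Generators

open ZWreath Encodable
open scoped commutatorElement

variable {ι H : Type*} [Group H]

/-- Looks up the family whose members are constant at the positive positions. -/
def innerLookup (i : ι) (n : ℕ) : Option ι := if n = 0 then none else some i

/-- The generator of `ℤ` in `H ≀ ℤ`, and the functions equal to `x i` at the positive integers and
to `1` elsewhere. -/
def innerGen (x : ι → H) : Option ι → ZWreath H := baseGen (lookupFun innerLookup x)

/-- Looks up the function supported at the powers of `4` with value `none` at `1` and `some i` at
`4 ^ (j + 1)` if `j` is a code of `i`. -/
def outerLookup [Encodable ι] (_ : Unit) (n : ℕ) : Option (Option ι) :=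
  -- `Nat.findGreatest` returns `0` when the search fails, so the exponent found has to be checked.
  -- The bound `n` suffices because `k < 4 ^ k`.
  if 4 ^ Nat.findGreatest (fun k => 4 ^ k = n) n = n then
    (Nat.findGreatest (fun k => 4 ^ k = n) n).casesOn (some none) fun j =>
      (decode j : Option ι).map some
  else none

/-- The two generators of the subgroup of `(H ≀ ℤ) ≀ ℤ`: `some ()` is a base element and `none` the
generator of `ℤ`. -/
def outerGen [Encodable ι] (x : ι → H) : Option Unit → ZWreath (ZWreath H) :=
  baseGen (lookupFun outerLookup (innerGen x))

theorem primrec_innerLookup [Primcodable ι] :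
    Primrec₂ (innerLookup : ι → ℕ → Option ι) :=
  Primrec.ite (Primrec.eq.comp Primrec.snd (Primrec.const 0)) (Primrec.const none)
    (Primrec.option_some.comp Primrec.fst)

theorem primrec_four_pow : Primrec fun k : ℕ => 4 ^ k := by
  refine (Primrec.nat_rec₁ (1 : ℕ) (f := fun _ y => y * 4)
    (Primrec.nat_mul.comp Primrec.snd (Primrec.const 4))).of_eq fun k => ?_
  induction k with
  | zero => rfl
  | succ k ih => simp only [ih, pow_succ]

theorem primrec_outerLookup [Primcodable ι] :
    Primrec₂ (outerLookup : Unit → ℕ → Option (Option ι)) := by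
  have hk : Primrec fun p : Unit × ℕ => Nat.findGreatest (fun k => 4 ^ k = p.2) p.2 :=
    Primrec.nat_findGreatest Primrec.snd (p := fun p k => 4 ^ k = p.2)
      (Primrec.eq.comp (primrec_four_pow.comp Primrec.snd) (Primrec.snd.comp Primrec.fst))
  have hd : Primrec₂ fun (_ : Unit × ℕ) (j : ℕ) => (decode j : Option ι).map some :=
    (Primrec.option_map (Primrec.decode.comp Primrec.snd)
      (Primrec.option_some.comp Primrec.snd).to₂).to₂
  exact Primrec.ite (Primrec.eq.comp (primrec_four_pow.comp hk) Primrec.snd)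
    (Primrec.nat_casesOn hk (Primrec.const (some none)) hd) (Primrec.const none)

theorem innerGen_none (x : ι → H) : innerGen x none = shift H := rfl

theorem lookupFun_innerLookup (x : ι → H) (i : ι) (n : ℤ) :
    lookupFun innerLookup x i n = if 0 < n then x i else 1 := by
  unfold lookupFun innerLookup
  by_cases h : 0 < n
  · have h0 : ¬ n.toNat = 0 := by omega
    simp [h0, h]
  · have h0 : n.toNat = 0 := by omega
    simp [h0, h]

theorem windowDetermined_innerGen (x : ι → H) : WindowDetermined (innerGen x) := by
  intro w
  have hneg : ∀ n : ℤ, n ≤ -w.length → coord (wordValue (innerGen x) w) n = 1 := by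
    intro n hn
    refine coord_wordValue_eq_one w n fun i p _ hp => ?_
    rw [lookupFun_innerLookup, if_neg (by omega)]
  refine ⟨fun n hn => hneg n hn.le, fun h n => ?_⟩
  by_cases h1 : n < -w.length
  · exact hneg n h1.le
  by_cases h2 : n ≤ 3 * w.length + 1
  · exact h n (by omega) h2
  -- Beyond `w.length` the whole reading window is positive, where base values are constant; the
  -- coordinate therefore equals the one at `w.length + 1`.
  · have := coord_wordValue_congr (MonoidHom.id H) (F := lookupFun innerLookup x)
      (F' := lookupFun innerLookup x) (w.length + 1 - n) w n fun i p hp _ => by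
        rw [lookupFun_innerLookup, MonoidHom.id_apply, lookupFun_innerLookup, if_pos (by omega),
          if_pos (by omega)]
    rw [innerGen, this, MonoidHom.id_apply]
    exact h _ (by omega) (by omega)

/-! ### The sparse base function and its window property. -/

section

variable [Encodable ι]

theorem outerLookup_four_pow (k : ℕ) : outerLookup (ι := ι) () (4 ^ k) =
    k.casesOn (some none) fun j => (decode j : Option ι).map some := by
  have h : Nat.findGreatest (fun l => 4 ^ l = 4 ^ k) (4 ^ k) = k := by
    have h1 : 4 ^ Nat.findGreatest (fun l => 4 ^ l = 4 ^ k) (4 ^ k) = 4 ^ k :=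
      Nat.findGreatest_spec (P := fun l => 4 ^ l = 4 ^ k) (Nat.lt_pow_self (by norm_num)).le rfl
    exact Nat.pow_right_injective (by norm_num) h1
  rw [outerLookup, h, if_pos rfl]

theorem exists_of_outerLookup_ne_none {n : ℕ} (h : outerLookup (ι := ι) () n ≠ none) :
    ∃ k, 4 ^ k = n := by
  unfold outerLookup at h
  split at h
  · exact ⟨_, ‹_›⟩
  · exact absurd rfl h

variable (x : ι → H)

/-- The base component of the first generator. -/
def baseFun : ℤ → ZWreath H := lookupFun outerLookup (innerGen x) ()

theorem outerGen_some : outerGen x (some ()) = ofFun (baseFun x) := rfl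

theorem outerGen_none : outerGen x none = shift (ZWreath H) := rfl

theorem exists_of_baseFun_ne_one {p : ℤ} (h : baseFun x p ≠ 1) : ∃ k : ℕ, p = 4 ^ k := by
  obtain ⟨k, hk⟩ := exists_of_outerLookup_ne_none (ι := ι) (n := p.toNat) fun h0 => h (by
    simp [baseFun, lookupFun, h0])
  refine ⟨k, ?_⟩
  have : 0 < 4 ^ k := by positivity
  have h2 : p = p.toNat := by omega
  rw [h2, ← hk]
  simp

theorem baseFun_four_pow (k : ℕ) : baseFun x (4 ^ k) =
    (k.casesOn (some none) fun j => (decode j : Option ι).map some :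
      Option (Option ι)).elim 1 (innerGen x) := by
  have h : ((4 : ℤ) ^ k).toNat = 4 ^ k := by
    have : ((4 : ℤ) ^ k) = ((4 ^ k : ℕ) : ℤ) := by simp
    rw [this, Int.toNat_natCast]
  rw [baseFun, lookupFun, h, outerLookup_four_pow]

theorem baseFun_one : baseFun x 1 = shift H := by
  simpa [innerGen_none] using baseFun_four_pow x 0

theorem baseFun_encode (i : ι) : baseFun x (4 ^ (encode i + 1)) = innerGen x (some i) := by
  simpa using baseFun_four_pow x (encode i + 1)

/-- Degree `1` at position `1` alone makes the inner degree of a coordinate count, with sign, the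
occurrences of `f` that contribute its value at `1`. -/
theorem degree_baseFun (p : ℤ) : degree (baseFun x p) = if p = 1 then 1 else 0 := by
  split
  · next h =>
    rw [h, baseFun_one]
    rfl
  · next h =>
    by_contra hd
    obtain ⟨k, rfl⟩ := exists_of_baseFun_ne_one x (p := p) fun h1 => hd (by simp [h1])
    rcases k with _ | j
    · simp at h
    · apply hd
      rw [baseFun_four_pow]
      rcases hj : (decode j : Option ι) with _ | i <;> simp [hj, innerGen, baseGen]

theorem windowDetermined_outerGen : WindowDetermined (outerGen x) := by
  intro w
  have hneg : ∀ n : ℤ, n < -w.length → coord (wordValue (outerGen x) w) n = 1 := by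
    intro n hn
    refine coord_wordValue_eq_one w n fun i p _ hp => ?_
    by_contra h1
    obtain ⟨k, rfl⟩ := exists_of_baseFun_ne_one x h1
    have : (0 : ℤ) < 4 ^ k := by positivity
    omega
  refine ⟨hneg, fun h n => ?_⟩
  by_cases h1 : n < -w.length
  · exact hneg n h1
  by_cases h2 : n ≤ 3 * w.length + 1
  · exact h n (by omega) h2
  by_cases hk : ∃ k : ℕ, n - w.length ≤ 4 ^ k ∧ (4 : ℤ) ^ k ≤ n + w.length
  · obtain ⟨k, hk1, hk2⟩ := hk
    -- Past `3 * w.length + 1`, the right end of the reading window is less than `4` times its left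
    -- end, so two powers of `4` cannot both fit.
    have huniq : ∀ l : ℕ, n - w.length ≤ 4 ^ l → (4 : ℤ) ^ l ≤ n + w.length → l = k := by
      intro l hl1 hl2
      have hsep : ∀ a b : ℕ, a < b → (4 : ℤ) * 4 ^ a ≤ 4 ^ b := by
        intro a b hab
        rw [← pow_succ']
        exact pow_le_pow_right₀ (by norm_num) hab
      rcases lt_trichotomy l k with hlk | hlk | hlk
      · have := hsep _ _ hlk
        omega
      · exact hlk
      · have := hsep _ _ hlk
        omega
    -- The coordinate is a power of `baseFun x (4 ^ k)`. Its exponent is computed in the model `ℤ ≀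
    -- ℤ`, with a single base value `1` placed at position `1`.
    have key := coord_wordValue_congr (zpowersHom (ZWreath H) (baseFun x (4 ^ k)))
      (F := lookupFun outerLookup (innerGen x))
      (F' := fun _ => Pi.mulSingle 1 (Multiplicative.ofAdd 1)) (1 - 4 ^ k) w n
      fun i p hp1 hp2 => by
        change baseFun x p = _
        by_cases hp : p = 4 ^ k
        · subst hp
          simp
        · have hp' : p + (1 - 4 ^ k) ≠ 1 := by omega
          rw [Pi.mulSingle_eq_of_ne hp', map_one]
          by_contra hne
          obtain ⟨l, rfl⟩ := exists_of_baseFun_ne_one x hne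
          exact hp (by rw [huniq l hp1 hp2])
    -- The same exponent is the degree of an actual coordinate, since degrees of `baseFun x` form
    -- exactly the base function of the model.
    have hdeg := coord_wordValue_congr (degreeHom H)
      (F := fun _ : Unit => (Pi.mulSingle 1 (Multiplicative.ofAdd 1) : ℤ → Multiplicative ℤ))
      (F' := lookupFun outerLookup (innerGen x)) 0 w (n + (1 - 4 ^ k)) fun i p _ _ => by
        rw [add_zero]
        change _ = degreeHom H (baseFun x p)
        rw [degreeHom_apply, degree_baseFun]
        by_cases hp : p = 1
        · subst hp
          simp
        · rw [Pi.mulSingle_eq_of_ne hp, if_neg hp]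
          rfl
    -- As `4 ^ k` is within `w.length` of `n`, this position is within `w.length` of `1`, hence
    -- inside the window.
    have h0 := h (n + (1 - 4 ^ k)) (by omega) (by omega)
    rw [outerGen] at h0
    rw [add_zero, h0, map_one (degreeHom H)] at hdeg
    rw [outerGen, key, hdeg, map_one]
  · refine coord_wordValue_eq_one w n fun i p hp1 hp2 => ?_
    by_contra hne
    obtain ⟨l, rfl⟩ := exists_of_baseFun_ne_one x hne
    exact hk ⟨l, hp1, hp2⟩

end

/-! ### Isolating the elements `x i` -/

/-- The commutator used to isolate a coordinate: the first factor is made of conjugates of `f` and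
`f⁻¹` by powers of `s`. -/
def isolator {G : Type*} [Group G] (f s : G) (m : ℕ) : G :=
  ⁅(s⁻¹ ^ m * f * s ^ m) * (s * s * f⁻¹ * s⁻¹ * s⁻¹), ⁅f, s⁆⁆

theorem map_isolator {G K : Type*} [Group G] [Group K] (φ : G →* K) (f s : G) (m : ℕ) :
    φ (isolator f s m) = isolator (φ f) (φ s) m := by
  simp [isolator, map_commutatorElement]

/-- In the first entry of the commutator the conjugates of `f` and `f⁻¹` cancel in the
abelianization, so both entries lie in the derived subgroup. This is the purpose of the factor
containing `f⁻¹`, which does not affect the isolated value. -/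
theorem isolator_mem_derivedSeries {G : Type*} [Group G] (f s : G) (m : ℕ) :
    isolator f s m ∈ derivedSeries G 2 := by
  rw [isolator, derivedSeries_succ G 1, derivedSeries_one]
  refine Subgroup.commutator_mem_commutator ?_
    (Subgroup.commutator_mem_commutator (Subgroup.mem_top _) (Subgroup.mem_top _))
  rw [← Abelianization.ker_of, MonoidHom.mem_ker]
  simp only [map_mul, map_pow, map_inv]
  generalize Abelianization.of f = a
  generalize Abelianization.of s = b
  rw [inv_pow, mul_comm (b ^ m)⁻¹ a, inv_mul_cancel_right, mul_comm b b, mul_comm (b * b) a⁻¹]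
  group

theorem four_pow_emod_three (k : ℕ) : (4 : ℤ) ^ k % 3 = 1 := by
  induction k with
  | zero => rfl
  | succ k ih => rw [pow_succ]; omega

/-- At `n` the value is `⁅F (n + m) * (F (n - 2))⁻¹, F n * (F (n - 1))⁻¹⁆` with `3 ∣ m`. Support in
the class `1` mod `3` kills one entry when `n` is `0` or `2` mod `3`, and leaves `⁅F (n + m), F n⁆`
otherwise. For the latter to be nontrivial, `n` and `n + m` must both be powers of `4`, which
happens only at `n = 1`. -/
theorem isolator_ofFun {M : Type*} [Group M] {F : ℤ → M}
    (hF : ∀ p, F p ≠ 1 → ∃ k : ℕ, p = 4 ^ k) (j : ℕ) :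
    isolator (ofFun F) (shift M) (4 ^ (j + 1) - 1) = single 1 ⁅F (4 ^ (j + 1)), F 1⁆ := by
  have hmod : ∀ p, p % 3 ≠ 1 → F p = 1 := by
    intro p hp
    by_contra h
    obtain ⟨k, rfl⟩ := hF p h
    exact hp (four_pow_emod_three k)
  have hm : ((4 ^ (j + 1) - 1 : ℕ) : ℤ) = 4 ^ (j + 1) - 1 := by
    rw [Nat.cast_sub (Nat.one_le_pow _ _ (by norm_num))]
    simp
  have hm3 := four_pow_emod_three (j + 1)
  generalize 4 ^ (j + 1) - 1 = m at hm
  have e1 : (shift M)⁻¹ ^ m = shift M ^ (-(m : ℤ)) := by simp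
  have e2 : shift M ^ m = shift M ^ (m : ℤ) := by simp
  apply ext_coord
  · simp [isolator, commutatorElement_def]
  intro n
  have hcoord : coord (isolator (ofFun F) (shift M) m) n =
      ⁅F (n + m) * (F (n - 2))⁻¹, F n * (F (n - 1))⁻¹⁆ := by
    have hB : ∀ n, coord ((((shift M)⁻¹ ^ m * ofFun F * shift M ^ m) *
        (shift M * shift M * (ofFun F)⁻¹ * (shift M)⁻¹ * (shift M)⁻¹))) n =
        F (n + m) * (F (n - 2))⁻¹ := by
      intro n
      rw [e1, e2]
      simp [degree_shift_zpow, coord_shift_zpow, -zpow_neg, -zpow_natCast]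
    have hBd : degree ((((shift M)⁻¹ ^ m * ofFun F * shift M ^ m) *
        (shift M * shift M * (ofFun F)⁻¹ * (shift M)⁻¹ * (shift M)⁻¹))) = 0 := by
      rw [e1, e2]
      simp [degree_shift_zpow, -zpow_neg, -zpow_natCast]
    rw [isolator, commutatorElement_def]
    simp only [coord_mul, coord_inv, degree_mul, degree_inv, hB, hBd,
      commutatorElement_def]
    simp
  rw [hcoord, coord_single]
  have h3 : n % 3 = 0 ∨ n % 3 = 1 ∨ n % 3 = 2 := by omega
  rcases h3 with h3 | h3 | h3
  · rw [Pi.mulSingle_eq_of_ne (by omega), hmod n (by omega), hmod (n - 1) (by omega)]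
    simp
  · rw [hmod (n - 1) (by omega), hmod (n - 2) (by omega), inv_one, mul_one, mul_one]
    by_cases hn : n = 1
    · subst hn
      rw [Pi.mulSingle_eq_same]
      congr 2
      omega
    · rw [Pi.mulSingle_eq_of_ne hn]
      by_cases hFn : F n = 1
      · simp [hFn]
      by_cases hFm : F (n + m) = 1
      · simp [hFm]
      obtain ⟨a, ha⟩ := hF _ hFn
      obtain ⟨c, hc⟩ := hF _ hFm
      exfalso
      have hj : (0 : ℤ) < 4 ^ j := by positivity
      have hpa : (0 : ℤ) < 4 ^ a := by positivity
      -- If `n ≠ 1`, then `n` and the larger number `n + m` are both divisible by `4`, whereas `m`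
      -- is `3` mod `4`.
      rw [pow_succ] at hm
      rcases a with _ | a
      · simp at ha
        omega
      · rcases c with _ | c
        · simp at hc
          omega
        · rw [pow_succ] at ha hc
          omega
  · rw [Pi.mulSingle_eq_of_ne (by omega), hmod (n + m) (by omega), hmod (n - 2) (by omega)]
    simp

/-- A step function divided by its translate by one is concentrated at the jump. -/
theorem commutator_innerGen (x : ι → H) (i : ι) :
    ⁅innerGen x (some i), shift H⁆ = single 1 (x i) := by
  apply ext_coord
  · simp [commutatorElement_def, innerGen, baseGen]
  intro n
  have : coord ⁅innerGen x (some i), shift H⁆ n =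
      lookupFun innerLookup x i n * (lookupFun innerLookup x i (n - 1))⁻¹ := by
    simp [commutatorElement_def, innerGen, baseGen]
  rw [this, lookupFun_innerLookup, lookupFun_innerLookup, coord_single]
  rcases lt_trichotomy n 1 with h | rfl | h
  · rw [if_neg (by omega), if_neg (by omega), Pi.mulSingle_eq_of_ne h.ne]
    simp
  · simp
  · rw [if_pos (by omega), if_pos (by omega), Pi.mulSingle_eq_of_ne h.ne']
    simp

theorem isolator_outerGen [Encodable ι] (x : ι → H) (i : ι) :
    isolator (outerGen x (some ())) (outerGen x none) (4 ^ (encode i + 1) - 1) =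
      single 1 (single 1 (x i)) := by
  rw [outerGen_some, outerGen_none, isolator_ofFun fun p => exists_of_baseFun_ne_one x,
    baseFun_encode, baseFun_one, commutator_innerGen]

/-- The word for `isolator` in the letters `0` and `1`. -/
def isolatorWord (m : ℕ) : GroupWord (Fin 2) :=
  let u : GroupWord (Fin 2) :=
    List.replicate m (1, false) ++ [(0, true)] ++ List.replicate m (1, true) ++
      [(1, true), (1, true), (0, false), (1, false), (1, false)]
  let v : GroupWord (Fin 2) := [(0, true), (1, true), (0, false), (1, false)]
  u ++ v ++ invWord u ++ invWord v

theorem wordValue_isolatorWord {G : Type*} [Group G] (g : Fin 2 → G) (m : ℕ) :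
    wordValue g (isolatorWord m) = isolator (g 0) (g 1) m := by
  simp [isolatorWord, isolator, wordValue_replicate, wordValue_cons, commutatorElement_def,
    mul_assoc]

theorem primrec_replicate {α : Type*} [Primcodable α] (a : α) :
    Primrec fun n : ℕ => List.replicate n a :=
  (Primrec.list_map (g := fun _ _ => a) Primrec.list_range (Primrec.const a).to₂).of_eq fun n => by
    simp

theorem primrec_isolatorWord : Primrec isolatorWord := by
  have hu : Primrec fun m : ℕ =>
      (List.replicate m (1, false) ++ [(0, true)] ++ List.replicate m (1, true) ++
      [(1, true), (1, true), (0, false), (1, false), (1, false)] : GroupWord (Fin 2)) :=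
    Primrec.list_append.comp (Primrec.list_append.comp (Primrec.list_append.comp
      (primrec_replicate _) (Primrec.const _)) (primrec_replicate _)) (Primrec.const _)
  exact Primrec.list_append.comp (Primrec.list_append.comp (Primrec.list_append.comp hu
    (Primrec.const _)) (primrec_invWord.comp hu)) (Primrec.const _)

theorem primrec_isolatorWord_encode [Primcodable ι] :
    Primrec fun i : ι => isolatorWord (4 ^ (encode i + 1) - 1) :=
  primrec_isolatorWord.comp (Primrec.nat_sub.comp (primrec_four_pow.comp
    (Primrec.succ.comp Primrec.encode)) (Primrec.const 1))

end Generators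

/-! ### Recursive enumerability by stages -/

section Stages

variable {α β : Type*} [Primcodable α] [Primcodable β]

/-- Stage `t` runs a code for the predicate with bound `t`, and `none` records that it has halted.
This matches the convention that `none` is the sign of the identity, so the sign machinery also
handles enumerable word problems. -/
theorem REPred.exists_stages {p : α → Prop} (hp : REPred p) :
    ∃ σ : ℕ → α → Option Bool, Computable₂ σ ∧
      (∀ s t, s ≤ t → ∀ a, σ s a = none → σ t a = none) ∧ ∀ a, p a ↔ ∃ t, σ t a = none := by
  obtain ⟨c, hc⟩ := Nat.Partrec.Code.exists_code.1 hp
  have hsome : ∀ (t : ℕ) (a : α),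
      ((Nat.Partrec.Code.evaln t c (Encodable.encode a)).casesOn (some true) fun _ => none :
        Option Bool) = none ↔ ∃ y, y ∈ Nat.Partrec.Code.evaln t c (Encodable.encode a) := by
    intro t a
    rcases Nat.Partrec.Code.evaln t c (Encodable.encode a) with _ | y <;> simp
  refine ⟨fun t a => (Nat.Partrec.Code.evaln t c (Encodable.encode a)).casesOn (some true)
    fun _ => none, ?_, ?_, ?_⟩
  · have h : Primrec fun q : ℕ × α => Nat.Partrec.Code.evaln q.1 c (Encodable.encode q.2) :=
      Nat.Partrec.Code.primrec_evaln.comp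
        ((Primrec.fst.pair (Primrec.const c)).pair (Primrec.encode.comp Primrec.snd))
    exact (Primrec.option_casesOn h (Primrec.const (some true))
      (Primrec.const none).to₂).to_comp
  · intro s t hst a ha
    obtain ⟨y, hy⟩ := (hsome s a).1 ha
    exact (hsome t a).2 ⟨y, Nat.Partrec.Code.evaln_mono hst hy⟩
  · intro a
    simp only [hsome]
    rw [exists_comm]
    simp only [← Nat.Partrec.Code.evaln_complete, hc]
    simp [Part.mem_assert_iff]

theorem REPred.of_stages {σ : α → ℕ → Option β} (hσ : Computable₂ σ) :
    REPred fun a => ∃ t, σ a t = none := by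
  have h : Computable₂ fun a t => ((σ a t).casesOn (some ()) fun _ => none : Option Unit) :=
    Computable.option_casesOn hσ (Computable.const (some ())) (Computable.const none).to₂
  refine (Partrec.rfindOpt h).dom_re.of_eq fun a => ?_
  rw [Nat.rfindOpt_dom]
  refine exists_congr fun t => ?_
  rcases σ a t with _ | b <;> simp

theorem ComputablePred.exists_sign {p : α → Prop} (hp : ComputablePred p) :
    ∃ σ : α → Option Bool, Computable σ ∧ ∀ a, p a ↔ σ a = none := by
  obtain ⟨f, hf, rfl⟩ := ComputablePred.computable_iff.1 hp
  refine ⟨fun a => bif f a then none else some true,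
    Computable.cond hf (Computable.const _) (Computable.const _), fun a => ?_⟩
  rcases h : f a <;> simp [h]

theorem ComputablePred.of_eq_value [DecidableEq β] {f : α → β} (hf : Computable f) (b : β) :
    ComputablePred fun a => f a = b :=
  ComputablePred.comp_computable
    (PrimrecPred.computablePred (Primrec.eq.comp Primrec.id (Primrec.const b))) hf

end Stages

/-! ### The two-generated group -/

section TwoGen

open ZWreath Encodable

variable {ι H : Type*} [Group H]

/-- The embedding of `H` in `(H ≀ ℤ) ≀ ℤ` at the coordinate `(1, 1)`. -/
def doubleSingle (H : Type*) [Group H] : H →* DoubleWreath H := (single 1).comp (single 1)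

theorem doubleSingle_injective : Function.Injective (doubleSingle H) :=
  (single_injective 1).comp (single_injective 1)

/-- The subgroup of `(H ≀ ℤ) ≀ ℤ` generated by the two elements `outerGen x`. -/
abbrev twoGen [Encodable ι] (x : ι → H) : Subgroup (DoubleWreath H) :=
  Subgroup.closure {outerGen x (some ()), outerGen x none}

/-- The generating pair of `twoGen x`. -/
abbrev twoGenPair [Encodable ι] (x : ι → H) : Fin 2 → twoGen x :=
  pairGen (outerGen x (some ())) (outerGen x none)

/-- Translation of words in the letters `0` and `1`. -/
def toOuter (w : GroupWord (Fin 2)) : GroupWord (Option Unit) :=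
  w.map fun p => ((![some (), none] : Fin 2 → Option Unit) p.1, p.2)

theorem primrec_toOuter : Primrec toOuter :=
  Primrec.list_map Primrec.id (((Primrec.dom_finite _).comp
    (Primrec.fst.comp Primrec.snd)).pair (Primrec.snd.comp Primrec.snd)).to₂

theorem generates_pairGen {W : Type*} [Group W] (f s : W) : Generates (pairGen f s) := by
  have h : Set.range (pairGen f s) =
      (fun a : Subgroup.closure ({f, s} : Set W) => (a : W)) ⁻¹' {f, s} := by
    ext a
    simp only [Set.mem_range, Set.mem_preimage, Set.mem_insert_iff, Set.mem_singleton_iff,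
      Fin.exists_fin_two, pairGen, Matrix.cons_val_zero, Matrix.cons_val_one, Subtype.ext_iff]
    exact or_congr eq_comm eq_comm
  rw [Generates, h]
  exact Subgroup.closure_closure_coe_preimage

theorem computableWrt_of_hasDecidableWordProblem {W : Type*} [Group W] {f s : W}
    (h : HasDecidableWordProblem (Subgroup.closure ({f, s} : Set W))) :
    ComputableWrt (pairGen f s) := by
  obtain ⟨n, g, hg, hc⟩ := h
  -- Only two words are needed, so no effectivity in their choice is required.
  choose w hw using hg.exists_word
  exact ComputableWrt.of_subst (MonoidHom.id _) Function.injective_id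
    (Primrec.dom_finite fun i => w (pairGen f s i)) (fun i => hw _) hc

theorem recursivelyPresentedWrt_of_hasRecursivePresentation {W : Type*} [Group W] {f s : W}
    (h : HasRecursivePresentation (Subgroup.closure ({f, s} : Set W))) :
    RecursivelyPresentedWrt (pairGen f s) := by
  obtain ⟨g, hg, hc⟩ := h
  choose w hw using hg.exists_word
  exact RecursivelyPresentedWrt.of_subst (MonoidHom.id _) Function.injective_id
    (Primrec.dom_finite fun i => w (pairGen f s i)) (fun i => hw _) hc

theorem hasRecursivePresentation_of_pairGen {W : Type*} [Group W] {f s : W}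
    (h : RecursivelyPresentedWrt (pairGen f s)) :
    HasRecursivePresentation (Subgroup.closure ({f, s} : Set W)) := by
  have hi : Primrec fun n : ℕ => (if n = 0 then 0 else 1 : Fin 2) :=
    Primrec.ite (Primrec.eq.comp Primrec.id (Primrec.const 0)) (Primrec.const 0)
      (Primrec.const 1)
  refine ⟨fun n => pairGen f s (if n = 0 then 0 else 1), ?_,
    RecursivelyPresentedWrt.of_subst (MonoidHom.id _) Function.injective_id
      (s := fun n => [((if n = 0 then 0 else 1 : Fin 2), true)])
      (Primrec.list_cons.comp (hi.pair (Primrec.const true)) (Primrec.const [])) (fun n => by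
        simp [wordValue_singleton]) h⟩
  rw [Generates, eq_top_iff]
  have hgen := generates_pairGen f s
  rw [Generates] at hgen
  rw [← hgen]
  refine Subgroup.closure_mono ?_
  rintro _ ⟨i, rfl⟩
  exact ⟨i, by fin_cases i <;> rfl⟩

section

variable [Encodable ι] (x : ι → H)

theorem coe_wordValue_twoGenPair (w : GroupWord (Fin 2)) :
    ((wordValue (twoGenPair x) w : twoGen x) : DoubleWreath H) =
      wordValue (outerGen x) (toOuter w) := by
  have h := map_wordValue (twoGen x).subtype (twoGenPair x) w
  rw [Subgroup.subtype_apply] at h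
  rw [h]
  simp only [wordValue, toOuter, List.map_map]
  congr 1
  refine List.map_congr_left fun p _ => ?_
  rcases p with ⟨i, b⟩
  fin_cases i <;> rfl

variable {x}

theorem isolatorWord_eq_doubleSingle (i : ι) :
    ((wordValue (twoGenPair x) (isolatorWord (4 ^ (encode i + 1) - 1)) : twoGen x) :
      DoubleWreath H) = doubleSingle H (x i) := by
  rw [wordValue_isolatorWord, ← Subgroup.subtype_apply, map_isolator]
  exact isolator_outerGen x i

theorem doubleSingle_mem (hx : Generates x) (h : H) : doubleSingle H h ∈ twoGen x := by
  have hle : (Subgroup.closure (Set.range x)).map (doubleSingle H) ≤ twoGen x := by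
    rw [MonoidHom.map_closure, Subgroup.closure_le]
    rintro _ ⟨_, ⟨i, rfl⟩, rfl⟩
    rw [← isolatorWord_eq_doubleSingle i]
    exact Subtype.property _
  refine hle (Subgroup.mem_map_of_mem _ ?_)
  rw [hx]
  trivial

/-- The embedding of `H` in the two-generated group. -/
def embed (hx : Generates x) : H →* twoGen x :=
  (doubleSingle H).codRestrict (twoGen x) (doubleSingle_mem hx)

variable (hx : Generates x)

theorem coe_embed (h : H) : (embed hx h : DoubleWreath H) = doubleSingle H h := rfl

theorem embed_injective : Function.Injective (embed hx) := fun _ _ h =>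
  doubleSingle_injective (congrArg Subtype.val h)

theorem isolatorWord_eq_embed (i : ι) :
    wordValue (twoGenPair x) (isolatorWord (4 ^ (encode i + 1) - 1)) = embed hx (x i) :=
  Subtype.ext (isolatorWord_eq_doubleSingle i)

theorem mem_range_embed_iff (u : twoGen x) : u ∈ (embed hx).range ↔
    ∃ h, (u : DoubleWreath H) = doubleSingle H h :=
  ⟨fun ⟨h, hh⟩ => ⟨h, by rw [← hh]; rfl⟩, fun ⟨h, hh⟩ => ⟨h, Subtype.ext hh.symm⟩⟩

/-! ### Derived length -/

theorem derivedSeries_twoGen_eq_bot {l : ℕ} (h : derivedSeries H l = ⊥) :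
    derivedSeries (twoGen x) (l + 2) = ⊥ := by
  have h2 : derivedSeries (DoubleWreath H) (l + 2) = ⊥ :=
    derivedSeries_succ_eq_bot (derivedSeries_succ_eq_bot h)
  have := map_derivedSeries_le_derivedSeries (twoGen x).subtype (l + 2)
  rw [h2, le_bot_iff, Subgroup.map_eq_bot_iff_of_injective _ (Subgroup.subtype_injective _)] at this
  exact this

/-- The generators already land in the second derived subgroup, being isolators; commutators
propagate this gain of two steps. -/
theorem map_embed_derivedSeries_le (hx : Generates x) (k : ℕ) :
    (derivedSeries H k).map (embed hx) ≤ derivedSeries (twoGen x) (k + 2) := by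
  induction k with
  | zero =>
    rw [derivedSeries_zero, ← hx, MonoidHom.map_closure, Subgroup.closure_le]
    rintro _ ⟨_, ⟨i, rfl⟩, rfl⟩
    rw [← isolatorWord_eq_embed hx i, wordValue_isolatorWord]
    exact isolator_mem_derivedSeries _ _ _
  | succ k ih =>
    rw [derivedSeries_succ, Subgroup.map_commutator, derivedSeries_succ]
    exact Subgroup.commutator_mono ih ih

theorem derivedSeries_one_twoGen_ne_bot : derivedSeries (twoGen x) 1 ≠ ⊥ := by
  intro h
  have hmem := Subgroup.commutator_mem_commutator (Subgroup.mem_top (twoGenPair x 0))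
    (Subgroup.mem_top (twoGenPair x 1))
  rw [← derivedSeries_zero, ← derivedSeries_succ, h, Subgroup.mem_bot,
    commutatorElement_eq_one_iff_mul_comm] at hmem
  have h2 : ofFun (baseFun x) * shift (ZWreath H) = shift (ZWreath H) * ofFun (baseFun x) :=
    congrArg Subtype.val hmem
  have h3 := congrArg (fun u => degree (coord u 1)) h2
  simp [degree_baseFun] at h3

theorem hasDerivedLength_twoGen (hx : Generates x) {l : ℕ} (hl : HasDerivedLength H l) :
    HasDerivedLength (twoGen x) (l + 2) := by
  refine ⟨derivedSeries_twoGen_eq_bot hl.1, fun n hn => ?_⟩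
  by_contra hlt
  have hn' : derivedSeries (twoGen x) (l + 1) = ⊥ := by
    rw [eq_bot_iff, ← show derivedSeries (twoGen x) n = ⊥ from hn]
    exact derivedSeries_antitone _ (by omega)
  -- For trivial `H` the embedding gives no lower bound, and noncommutation of the two generators
  -- replaces it.
  rcases l with _ | l
  · exact derivedSeries_one_twoGen_ne_bot hn'
  · have := map_embed_derivedSeries_le hx l
    rw [hn', le_bot_iff, Subgroup.map_eq_bot_iff_of_injective _ (embed_injective hx)] at this
    have := hl.2 this
    omega

/-! ### Orders -/

/-- The order on `twoGen x` that extends an order on `H`. -/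
def twoGenLE (r : H → H → Prop) (u v : twoGen x) : Prop :=
  LexLE (LexLE r) (u : DoubleWreath H) v

theorem twoGenLE_embed {r : H → H → Prop} (hr : IsLeftOrder r) (a b : H) :
    twoGenLE r (embed hx a) (embed hx b) ↔ r a b := by
  have := hr.1
  refine (lexLE_single (LexLE.refl r) 1 _ _).trans (lexLE_single (fun a => refl a) 1 a b)

theorem twoGenLE_mul_left {r : H → H → Prop} (hr : IsLeftOrder r) (a b c : twoGen x)
    (h : twoGenLE r b c) : twoGenLE r (a * b) (a * c) :=
  LexLE.mul_left (fun _ _ _ => LexLE.mul_left hr.2 _) _ h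

theorem isLeftOrder_twoGenLE {r : H → H → Prop} (hr : IsLeftOrder r) :
    IsLeftOrder (twoGenLE (x := x) r) := by
  have := hr.1
  have hanti : ∀ a b, r a b → r b a → a = b := fun a b => antisymm
  have htrans : ∀ a b c, r a b → r b c → r a c := fun a b c => _root_.trans
  have hcomp : ComparableWithOne r x := fun w => total_of r _ _
  have hcomp1 : ComparableWithOne (LexLE r) (innerGen x) :=
    hcomp.lexLE (windowDetermined_innerGen x)
  have hcomp2 : ComparableWithOne (LexLE (LexLE r)) (outerGen x) :=
    hcomp1.lexLE (windowDetermined_outerGen x)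
  refine ⟨{ refl := fun u => LexLE.refl _ _
            trans := fun u v w => LexLE.trans (fun _ _ => LexLE.antisymm hanti)
              fun _ _ _ => LexLE.trans hanti htrans
            antisymm := fun u v huv hvu => Subtype.ext
              (LexLE.antisymm (fun _ _ => LexLE.antisymm hanti) huv hvu)
            total := fun u v => ?_ }, twoGenLE_mul_left hr⟩
  -- Left invariance reduces totality to comparing `u⁻¹ * v` with `1`, and this quotient is given by
  -- a word.
  obtain ⟨w, hw⟩ := (generates_pairGen _ _).exists_word (u⁻¹ * v)
  have hone : twoGenLE r 1 (u⁻¹ * v) ∨ twoGenLE r (u⁻¹ * v) 1 := by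
    rw [← hw, twoGenLE, twoGenLE, coe_wordValue_twoGenPair]
    exact hcomp2 _
  rcases hone with h | h
  · left
    simpa using twoGenLE_mul_left hr u _ _ h
  · right
    simpa using twoGenLE_mul_left hr u _ _ h

theorem isBiOrder_twoGenLE {r : H → H → Prop} (hr : IsBiOrder r) :
    IsBiOrder (twoGenLE (x := x) r) :=
  ⟨isLeftOrder_twoGenLE hr.1, fun _ _ _ h =>
    LexLE.mul_right (fun _ _ _ => LexLE.mul_right hr.2 _) _ h⟩

/-! ### Subnormality -/

theorem exists_subnormal_chain (hx : Generates x) : ∃ N₁ N₂ : Subgroup (twoGen x),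
    (embed hx).range ≤ N₁ ∧ N₁ ≤ N₂ ∧ ((embed hx).range.subgroupOf N₁).Normal ∧
      (N₁.subgroupOf N₂).Normal ∧ N₂.Normal := by
  let D : twoGen x →* Multiplicative ℤ := (degreeHom (ZWreath H)).comp (twoGen x).subtype
  have hD : ∀ u, u ∈ D.ker ↔ degree (u : DoubleWreath H) = 0 := fun u => Iff.rfl
  let N : Subgroup (twoGen x) :=
    { carrier := {u | degree (u : DoubleWreath H) = 0 ∧
        ∀ n, degree (coord (u : DoubleWreath H) n) = 0}
      one_mem' := by simp
      mul_mem' := by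
        rintro a b ⟨ha, ha'⟩ ⟨hb, hb'⟩
        exact ⟨by simp [ha, hb], fun n => by simp [ha', hb']⟩
      inv_mem' := by
        rintro a ⟨ha, ha'⟩
        exact ⟨by simp [ha], fun n => by simp [ha']⟩ }
  have hN : ∀ u, u ∈ N ↔ degree (u : DoubleWreath H) = 0 ∧
      ∀ n, degree (coord (u : DoubleWreath H) n) = 0 := fun u => Iff.rfl
  refine ⟨N, D.ker, ?_, fun u hu => hu.1, ⟨?_⟩, ⟨?_⟩, inferInstance⟩
  · rintro _ ⟨h, rfl⟩
    refine ⟨rfl, fun n => ?_⟩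
    rw [coe_embed]
    by_cases hn : n = 1
    · subst hn
      simp [doubleSingle]
    · simp [doubleSingle, Pi.mulSingle_eq_of_ne hn]
  · rintro ⟨u, hu⟩ hu' ⟨v, hv⟩
    rw [Subgroup.mem_subgroupOf] at hu' ⊢
    rw [mem_range_embed_iff] at hu' ⊢
    obtain ⟨h, hh⟩ := hu'
    obtain ⟨hv, hv'⟩ := (hN v).1 hv
    -- Elements of `N` move no coordinates, so conjugation by `v` acts at `(1, 1)` through the entry
    -- of `v` there.
    refine ⟨coord (coord (v : DoubleWreath H) 1) 1 * h * (coord (coord (v : DoubleWreath H) 1) 1)⁻¹,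
      ?_⟩
    have hval : (((⟨v, ‹_›⟩ * ⟨u, hu⟩ * ⟨v, ‹_›⟩⁻¹ : N) : twoGen x) : DoubleWreath H) =
        (v : DoubleWreath H) * doubleSingle H h * (v : DoubleWreath H)⁻¹ := by
      rw [← hh]
      rfl
    rw [hval]
    apply ext_coord
    · simp [doubleSingle]
    intro n
    by_cases hn : n = 1
    · subst hn
      apply ext_coord
      · simp [doubleSingle, hv]
      intro m
      by_cases hm : m = 1
      · subst hm
        simp [doubleSingle, hv, hv']
      · simp [doubleSingle, hv, hv', Pi.mulSingle_eq_of_ne hm]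
    · simp [doubleSingle, hv, Pi.mulSingle_eq_of_ne hn]
  · rintro ⟨u, hu⟩ hu' ⟨v, hv⟩
    rw [Subgroup.mem_subgroupOf] at hu' ⊢
    obtain ⟨hu1, hu2⟩ := (hN u).1 hu'
    rw [hD] at hv
    exact ⟨by simp [hu1, hv], fun n => by simp [hu1, hu2, hv]⟩

end

/-! ### Algorithms -/

variable [Primcodable ι] {x : ι → H}

/-- The sign of the element of `twoGen x` represented by a word, computed from a sign function on
words for `H`. -/
def twoGenSign (σ : GroupWord ι → Option Bool) (w : GroupWord (Fin 2)) : Option Bool :=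
  liftSign outerLookup (liftSign innerLookup σ) (toOuter w)

theorem computable_twoGenSign {T : Type*} [Primcodable T]
    {σ : T → GroupWord ι → Option Bool} (hσ : Computable₂ σ) :
    Computable₂ fun t w => twoGenSign (σ t) w :=
  (computable_liftSign primrec_outerLookup (computable_liftSign primrec_innerLookup hσ)).comp
    Computable.fst (primrec_toOuter.to_comp.comp Computable.snd)

theorem wordValue_twoGenPair_eq_one_iff {σ : ℕ → GroupWord ι → Option Bool}
    (hmono : ∀ s t, s ≤ t → ∀ c, σ s c = none → σ t c = none)
    (hσ : ∀ c, wordValue x c = 1 ↔ ∃ t, σ t c = none) (w : GroupWord (Fin 2)) :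
    wordValue (twoGenPair x) w = 1 ↔ ∃ t, twoGenSign (σ t) w = none := by
  rw [← OneMemClass.coe_eq_one, coe_wordValue_twoGenPair]
  exact wordValue_eq_one_iff_exists_liftSign (windowDetermined_outerGen x)
    (σ := fun t => liftSign innerLookup (σ t))
    (fun s t hst _ => liftSign_eq_none_mono (hmono s t hst))
    (wordValue_eq_one_iff_exists_liftSign (windowDetermined_innerGen x) hmono hσ) _

theorem recursivelyPresentedWrt_twoGenPair (h : RecursivelyPresentedWrt x) :
    RecursivelyPresentedWrt (twoGenPair x) := by
  obtain ⟨σ, hc, hmono, hσ⟩ := REPred.exists_stages h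
  have hs : Computable₂ fun w t => twoGenSign (σ t) w :=
    (computable_twoGenSign hc).comp Computable.snd Computable.fst
  exact (REPred.of_stages hs).of_eq fun w => (wordValue_twoGenPair_eq_one_iff hmono hσ w).symm

theorem computableWrt_twoGenPair (h : ComputableWrt x) : ComputableWrt (twoGenPair x) := by
  obtain ⟨σ, hc, hσ⟩ := ComputablePred.exists_sign h
  have hc' : Computable₂ fun (_ : Unit) w => σ w := hc.comp Computable.snd
  refine (ComputablePred.of_eq_value (β := Option Bool)
    ((computable_twoGenSign hc').comp (Computable.const ()) Computable.id) none).of_eq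
      fun w => ?_
  -- A decision procedure is treated as a constant sequence of stages.
  rw [wordValue_twoGenPair_eq_one_iff (σ := fun _ => σ) (fun _ _ _ _ => id)
    (fun c => by simpa using hσ c)]
  simp

/-- An element lies in the image exactly when it equals the image of its own entry at `(1, 1)`. That
entry is a computable word in `x`, which isolator words turn into a word in the two generators, so
membership becomes an instance of the word problem. -/
theorem computablePred_mem_range_embed (hx : Generates x) (h : ComputableWrt x) :
    ComputablePred fun u : GroupWord (Fin 2) =>
      wordValue (twoGenPair x) u ∈ (embed hx).range := by
  let c : GroupWord (Fin 2) → GroupWord ι := fun u =>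
    coordWord innerLookup (coordWord outerLookup (toOuter u) (1, 0)) (1, 0)
  have hc : Primrec c := (primrec_coordWord primrec_innerLookup).comp
    ((primrec_coordWord primrec_outerLookup).comp primrec_toOuter (Primrec.const (1, 0)))
    (Primrec.const (1, 0))
  have hcval : ∀ u, wordValue x (c u) =
      coord (coord ((wordValue (twoGenPair x) u : twoGen x) : DoubleWreath H) 1) 1 := by
    intro u
    rw [wordValue_coordWord, coe_wordValue_twoGenPair]
    have h1 := wordValue_coordWord outerLookup (innerGen x) (toOuter u) (1, 0)
    rw [innerGen] at h1
    rw [h1]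
    simp [outerGen, innerGen]
  let d : GroupWord (Fin 2) → GroupWord (Fin 2) := fun u =>
    invWord u ++ substWord (fun i => isolatorWord (4 ^ (encode i + 1) - 1)) (c u)
  have hd : Primrec d := Primrec.list_append.comp primrec_invWord
    ((primrec_substWord primrec_isolatorWord_encode).comp hc)
  refine (ComputablePred.comp_computable (computableWrt_twoGenPair h) hd.to_comp).of_eq fun u => ?_
  have hval : wordValue (twoGenPair x) (d u) =
      (wordValue (twoGenPair x) u)⁻¹ * embed hx (wordValue x (c u)) := by
    rw [wordValue_append, wordValue_invWord, wordValue_substWord, map_wordValue]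
    simp only [isolatorWord_eq_embed hx]
  rw [hval, inv_mul_eq_one]
  constructor
  · intro hu
    exact ⟨_, hu.symm⟩
  · rintro ⟨a, ha⟩
    rw [hcval, ← ha]
    simp [coe_embed, doubleSingle]

theorem computableOrderWrt_twoGenLE {r : H → H → Prop} (hr : IsLeftOrder r)
    (h : ComputableOrderWrt x r) : ComputableOrderWrt (twoGenPair x) (twoGenLE r) := by
  have := hr.1
  have hpos : ComputablePred fun c : GroupWord ι => r 1 (wordValue x c) :=
    ComputablePred.comp_computable h ((Computable.const []).pair Computable.id)
  have hneg : ComputablePred fun c : GroupWord ι => r (wordValue x c) 1 :=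
    ComputablePred.comp_computable h (Computable.id.pair (Computable.const []))
  obtain ⟨p, hp, hp'⟩ := ComputablePred.computable_iff.1 hpos
  obtain ⟨q, hq, hq'⟩ := ComputablePred.computable_iff.1 hneg
  have hp'' : ∀ c, r 1 (wordValue x c) ↔ p c = true := fun c => iff_of_eq (congrFun hp' c)
  have hq'' : ∀ c, r (wordValue x c) 1 ↔ q c = true := fun c => iff_of_eq (congrFun hq' c)
  let σ : GroupWord ι → Option Bool := fun c =>
    bif p c then bif q c then none else some true else some false
  have hσc : Computable σ := Computable.cond hp (Computable.cond hq (Computable.const _)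
    (Computable.const _)) (Computable.const _)
  have hσ : IsSignFor r x σ := by
    intro c
    have hone : wordValue x c = 1 ↔ p c = true ∧ q c = true := by
      rw [← hp'', ← hq'']
      constructor
      · intro h1
        rw [h1]
        exact ⟨refl 1, refl 1⟩
      · rintro ⟨h1, h2⟩
        exact antisymm h2 h1
    rw [ne_eq, hone, hp'']
    rcases h1 : p c <;> rcases h2 : q c <;> simp [σ, h1, h2]
  have hσ2 : IsSignFor (LexLE (LexLE r)) (outerGen x)
      (liftSign outerLookup (liftSign innerLookup σ)) :=
    IsSignFor.lift (windowDetermined_outerGen x) (IsSignFor.lift (windowDetermined_innerGen x) hσ)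
  have hσ' : Computable₂ fun (_ : Unit) w => σ w := hσc.comp Computable.snd
  have hdiff : Primrec fun u : GroupWord (Fin 2) × GroupWord (Fin 2) => invWord u.1 ++ u.2 :=
    Primrec.list_append.comp (primrec_invWord.comp Primrec.fst) Primrec.snd
  -- The comparison holds exactly when the quotient is not negative, so one sign is enough to decide
  -- it.
  have hcomp : ComputablePred fun u : GroupWord (Fin 2) × GroupWord (Fin 2) =>
      ¬ twoGenSign σ (invWord u.1 ++ u.2) = some false :=
    (ComputablePred.of_eq_value ((computable_twoGenSign hσ').comp (Computable.const ())
      hdiff.to_comp) (some false)).not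
  refine hcomp.of_eq fun u => ?_
  have hmul : twoGenLE r (wordValue (twoGenPair x) u.1) (wordValue (twoGenPair x) u.2) ↔
      LexLE (LexLE r) 1 (wordValue (outerGen x) (toOuter (invWord u.1 ++ u.2))) := by
    rw [← coe_wordValue_twoGenPair, wordValue_append, wordValue_invWord]
    constructor
    · intro h1
      have := twoGenLE_mul_left hr (wordValue (twoGenPair x) u.1)⁻¹ _ _ h1
      rwa [inv_mul_cancel] at this
    · intro h1
      have := twoGenLE_mul_left hr (wordValue (twoGenPair x) u.1) 1
        ((wordValue (twoGenPair x) u.1)⁻¹ * wordValue (twoGenPair x) u.2) h1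
      rwa [mul_one, mul_inv_cancel_left] at this
  rw [hmul, twoGenSign]
  obtain ⟨h1, h2⟩ := hσ2 (toOuter (invWord u.1 ++ u.2))
  rcases hs : liftSign outerLookup (liftSign innerLookup σ) (toOuter (invWord u.1 ++ u.2)) with
    _ | _ | _
  · exact iff_of_true (by simp) (by rw [h1.1 hs]; exact LexLE.refl _ _)
  · refine iff_of_false (by simp) fun h3 => ?_
    by_cases h4 : wordValue (outerGen x) (toOuter (invWord u.1 ++ u.2)) = 1
    · rw [h1.2 h4] at hs
      simp at hs
    · rw [h2.2 ⟨h4, h3⟩] at hs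
      simp at hs
  · exact iff_of_true (by simp) (h2.1 hs).2

end TwoGen

theorem theorem3 {H : Type*} [Group H] {ι : Type*} [Primcodable ι] (x : ι → H)
    (hx : Generates x) :
    ∃ (f s : DoubleWreath H)
      (Φ : H →* Subgroup.closure ({f, s} : Set (DoubleWreath H))),
      Function.Injective Φ ∧
      -- the images of the generators are represented by computable words in `f, s`
      (∃ w : ι → GroupWord (Fin 2), Computable w ∧
        ∀ i, wordValue (pairGen f s) (w i) = Φ (x i)) ∧
      -- derived length
      (∀ l : ℕ, HasDerivedLength H l →
        HasDerivedLength (Subgroup.closure ({f, s} : Set (DoubleWreath H))) (l + 2)) ∧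
      -- recursive presentations
      (HasRecursivePresentation (Subgroup.closure ({f, s} : Set (DoubleWreath H))) ↔
        RecursivelyPresentedWrt x) ∧
      -- decidability of the word problem
      (HasDecidableWordProblem (Subgroup.closure ({f, s} : Set (DoubleWreath H))) ↔
        ComputableWrt x) ∧
      -- decidability of membership in the image of `H`
      (ComputableWrt x →
        ComputablePred fun u : GroupWord (Fin 2) => wordValue (pairGen f s) u ∈ Φ.range) ∧
      -- left orders extend, also computably
      (∀ r : H → H → Prop, IsLeftOrder r →
        ∃ r' : Subgroup.closure ({f, s} : Set (DoubleWreath H)) →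
            Subgroup.closure ({f, s} : Set (DoubleWreath H)) → Prop,
          IsLeftOrder r' ∧ (∀ a b : H, r' (Φ a) (Φ b) ↔ r a b) ∧
          (ComputableOrderWrt x r → ComputableOrderWrt (pairGen f s) r')) ∧
      -- bi-orders extend, also computably
      (∀ r : H → H → Prop, IsBiOrder r →
        ∃ r' : Subgroup.closure ({f, s} : Set (DoubleWreath H)) →
            Subgroup.closure ({f, s} : Set (DoubleWreath H)) → Prop,
          IsBiOrder r' ∧ (∀ a b : H, r' (Φ a) (Φ b) ↔ r a b) ∧
          (ComputableOrderWrt x r → ComputableOrderWrt (pairGen f s) r')) ∧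
      -- the image of `H` is subnormal, of depth three
      (∃ N₁ N₂ : Subgroup (Subgroup.closure ({f, s} : Set (DoubleWreath H))),
        Φ.range ≤ N₁ ∧ N₁ ≤ N₂ ∧
        (Φ.range.subgroupOf N₁).Normal ∧ (N₁.subgroupOf N₂).Normal ∧ N₂.Normal) := by
  have hw := fun i : ι => isolatorWord_eq_embed hx i
  refine ⟨outerGen x (some ()), outerGen x none, embed hx, embed_injective hx,
    ⟨_, primrec_isolatorWord_encode.to_comp, hw⟩, fun l => hasDerivedLength_twoGen hx,
    ⟨fun h => ?_, fun h => ?_⟩, ⟨fun h => ?_, fun h => ?_⟩, computablePred_mem_range_embed hx,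
    fun r hr => ⟨twoGenLE r, isLeftOrder_twoGenLE hr, twoGenLE_embed hx hr,
      computableOrderWrt_twoGenLE hr⟩,
    fun r hr => ⟨twoGenLE r, isBiOrder_twoGenLE hr, twoGenLE_embed hx hr.1,
      computableOrderWrt_twoGenLE hr.1⟩, exists_subnormal_chain hx⟩
  · exact RecursivelyPresentedWrt.of_subst (embed hx) (embed_injective hx)
      primrec_isolatorWord_encode hw (recursivelyPresentedWrt_of_hasRecursivePresentation h)
  · exact hasRecursivePresentation_of_pairGen (recursivelyPresentedWrt_twoGenPair h)
  · exact ComputableWrt.of_subst (embed hx) (embed_injective hx)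
      primrec_isolatorWord_encode hw (computableWrt_of_hasDecidableWordProblem h)
  · exact ⟨2, _, generates_pairGen _ _, computableWrt_twoGenPair h⟩
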